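/- Let $Y$ be a closed manifold of dimension $2m+1$ with a contact form $\alpha$ whose Reeb vector field $R$ generates a free action of the circle $\mathbb{R}/T_0\mathbb{Z}$; let $\pi_\Sigma\colon Y\to\Sigma$ be the quotient and $\omega$ the symplectic form on $\Sigma$ with $\pi_\Sigma^*\omega=d\alpha$. Let $N\Sigma\to\Sigma$ be the complex line bundle with unit circle bundle $Y$, in which rotation of the fibres runs against the Reeb flow (the normal bundle of $\Sigma$ in the symplectic cut $X$), and let $K>0$ be such that $c_1(N\Sigma)=[K\omega]$ in $H^2(\Sigma;\mathbb{R})$; that is, $Y$ has a connection $1$-form $\Theta$ with $\Theta(-T_0R)=1$ and $d\Theta=-K\pi_\Sigma^*\omega$. Let $J_Y$ be an almost complex structure on $\mathbb{R}\times Y$ that is compatible with $d(e^r\alpha)$, cylindrical ($r$-invariant, $J_Y\partial_r=R$, $J_Y$ preserves $\ker\alpha$) and Reeb-invariant. Let $H(r,y)=h(e^r)$, where $h\colon(0,\infty)\to\mathbb{R}$ is smooth, $h(\rho)=0$ for $\rho\le 2$, $h'(\rho)>0$ and $h''(\rho)>0$ for $\rho>2$, and $h'(\rho)\to\infty$ as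 $\rho\to\infty$; its Hamiltonian vector field is $X_H=h'(e^r)R$. A Hamiltonian orbit of multiplicity $k\ge1$ is a $1$-periodic orbit of $X_H$ in $\{b\}\times Y$, where $h'(e^{b})=kT_0$. A Reeb orbit of multiplicity $k\ge 1$ is a loop $\gamma\colon\mathbb{R}/\mathbb{Z}\to Y$ with $\dot\gamma=kT_0R(\gamma)$. Let $\Gamma\subset\mathbb{R}\times S^1$ be a finite set ($S^1=\mathbb{R}/\mathbb{Z}$) and let $\tilde v=(b,v)\colon\mathbb{R}\times S^1\setminus\Gamma\to\mathbb{R}\times Y$ be a punctured Floer cylinder: a smooth solution of $\partial_s\tilde v+J_Y(\partial_t\tilde v-X_H(\tilde v))=0$ which converges to a Hamiltonian orbit of multiplicity $k_+$ as $s\to+\infty$; which converges, as $s\to-\infty$, either to a Hamiltonian orbit of multiplicity $k_-$ or to a Reeb orbit of multiplicity $k_-$ in $\{-\infty\}\times Y$; and which, in coordinates $z+e^{2\pi(\rho+i\theta)}$, $\rho\to-\infty$, around each augmentation puncture $z\in\Gamma$, converges to a Reeb orbit of multiplicity $k(z)$ in $\{-\infty\}\times Y$. (Convergence of loops in $Y$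 is in $C^1$; convergence of the $\mathbb{R}$-component is uniform.) Let $w\colon\mathbb{CP}^1\to\Sigma$ be the continuous extension of $\pi_\Sigma\circ v$, where $(s,t)$ corresponds to $e^{2\pi(s+it)}\in\mathbb{CP}^1$; let $A=w_*[\mathbb{CP}^1]\in H_2(\Sigma;\mathbb{Z})$ and $\omega(A)=\int_{\mathbb{CP}^1}w^*\omega$. Then this integral converges absolutely, $$k_+-k_--\sum_{z\in\Gamma}k(z)=K\,\omega(A)\ge 0,$$ and if $A\neq0$ or $\Gamma\neq\emptyset$, then $k_+>k_-$. -/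

import Mathlib

open Set Filter Topology Manifold MeasureTheory
open scoped ContDiff

noncomputable section

namespace SplitFloer

/-! ### Differential forms on boundaryless manifolds -/

section Forms

variable {n : ℕ} {M : Type} [TopologicalSpace M] [ChartedSpace (EuclideanSpace ℝ (Fin n)) M]

/-- The differential at `e` of the inverse of the preferred chart at `x₀`. -/
def chartSymmDeriv (x₀ : M) (e : EuclideanSpace ℝ (Fin n)) :
    EuclideanSpace ℝ (Fin n) →L[ℝ] TangentSpace (𝓡 n) ((extChartAt (𝓡 n) x₀).symm e) :=
  mfderiv 𝓘(ℝ, EuclideanSpace ℝ (Fin n)) (𝓡 n) (extChartAt (𝓡 n) x₀).symm e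

/-- A 1-form written in the preferred chart at `x₀` (pullback by the inverse chart). -/
def chartRep (β : ∀ x : M, TangentSpace (𝓡 n) x →L[ℝ] ℝ) (x₀ : M)
    (e : EuclideanSpace ℝ (Fin n)) : EuclideanSpace ℝ (Fin n) →L[ℝ] ℝ :=
  (β ((extChartAt (𝓡 n) x₀).symm e)).comp (chartSymmDeriv x₀ e)

/-- A 1-form is smooth if it is smooth in charts. -/
def SmoothOneForm (β : ∀ x : M, TangentSpace (𝓡 n) x →L[ℝ] ℝ) : Prop :=
  ∀ x₀ : M, ContDiffOn ℝ ∞ (chartRep β x₀) (extChartAt (𝓡 n) x₀).target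

/-- A field of bilinear forms on the tangent spaces is smooth if it is smooth in charts. -/
def SmoothBilinForm
    (η : ∀ x : M, TangentSpace (𝓡 n) x →L[ℝ] TangentSpace (𝓡 n) x →L[ℝ] ℝ) : Prop :=
  ∀ x₀ : M, ∀ a b : EuclideanSpace ℝ (Fin n), ContDiffOn ℝ ∞
    (fun e => η ((extChartAt (𝓡 n) x₀).symm e) (chartSymmDeriv x₀ e a) (chartSymmDeriv x₀ e b))
    (extChartAt (𝓡 n) x₀).target

/-- The exterior derivative of a 1-form, `dβ(u, v) = ∂_u (β v) - ∂_v (β u)`, computed at `x` in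
the preferred chart at `x`; in that chart the tangent space at `x` is the model space itself, with
`u` and `v` as their own coordinate vectors. -/
def extD (β : ∀ x : M, TangentSpace (𝓡 n) x →L[ℝ] ℝ) (x : M) (u v : TangentSpace (𝓡 n) x) : ℝ :=
  let u' : EuclideanSpace ℝ (Fin n) := u
  let v' : EuclideanSpace ℝ (Fin n) := v
  fderiv ℝ (fun e => chartRep β x e v') (extChartAt (𝓡 n) x x) u' -
    fderiv ℝ (fun e => chartRep β x e u') (extChartAt (𝓡 n) x x) v'

end Forms

/-! ### The contact manifold `Y` and its quotient -/

/-- A contact form `α` on `Y` (of dimension `2m+1`) whose Reeb flow is a free action of the circle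
`ℝ / T₀ℤ`, together with the quotient `proj : Y → S` by this action (`S` is the manifold usually
called `Σ`) and the form `ωS` on `S` induced by `dα`. -/
structure ReebCircleBundle (m : ℕ)
    (Y : Type) [TopologicalSpace Y] [ChartedSpace (EuclideanSpace ℝ (Fin (2 * m + 1))) Y]
    (S : Type) [TopologicalSpace S] [ChartedSpace (EuclideanSpace ℝ (Fin (2 * m))) S] where
  /-- the contact form -/
  α : ∀ y : Y, TangentSpace (𝓡 (2 * m + 1)) y →L[ℝ] ℝ
  α_smooth : SmoothOneForm α
  /-- the Reeb vector field -/
  R : ∀ y : Y, TangentSpace (𝓡 (2 * m + 1)) y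
  α_R : ∀ y, α y (R y) = 1
  dα_R : ∀ y v, extD α y (R y) v = 0
  /-- `α` is a contact form: `dα` is nondegenerate on the hyperplane field `ξ = ker α` -/
  contact : ∀ y u, α y u = 0 → (∀ v, α y v = 0 → extD α y u v = 0) → u = 0
  /-- the Reeb flow -/
  flow : ℝ → Y → Y
  flow_smooth : ContMDiff (𝓘(ℝ, ℝ).prod (𝓡 (2 * m + 1))) (𝓡 (2 * m + 1)) ∞
    (fun p : ℝ × Y => flow p.1 p.2)
  flow_zero : ∀ y, flow 0 y = y
  flow_integral : ∀ y, IsMIntegralCurve (I := 𝓡 (2 * m + 1)) (fun t => flow t y) R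
  /-- the common minimal period of the Reeb orbits -/
  T₀ : ℝ
  T₀_pos : 0 < T₀
  flow_free : ∀ t y, flow t y = y ↔ ∃ j : ℤ, t = j * T₀
  /-- the quotient map -/
  proj : Y → S
  proj_smooth : ContMDiff (𝓡 (2 * m + 1)) (𝓡 (2 * m)) ∞ proj
  proj_surjective : Function.Surjective proj
  proj_submersion : ∀ y,
    Function.Surjective (mfderiv (𝓡 (2 * m + 1)) (𝓡 (2 * m)) proj y)
  proj_eq_iff : ∀ y y', proj y = proj y' ↔ ∃ t, flow t y = y'
  /-- the symplectic form on the quotient, determined by `proj^* ωS = dα` -/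
  ωS : ∀ x : S, TangentSpace (𝓡 (2 * m)) x →L[ℝ] TangentSpace (𝓡 (2 * m)) x →L[ℝ] ℝ
  ωS_smooth : SmoothBilinForm ωS
  ωS_proj : ∀ y u v,
    ωS (proj y) (mfderiv (𝓡 (2 * m + 1)) (𝓡 (2 * m)) proj y u)
      (mfderiv (𝓡 (2 * m + 1)) (𝓡 (2 * m)) proj y v) = extD α y u v

section

variable {m : ℕ}
  {Y : Type} [TopologicalSpace Y] [ChartedSpace (EuclideanSpace ℝ (Fin (2 * m + 1))) Y]
  {S : Type} [TopologicalSpace S] [ChartedSpace (EuclideanSpace ℝ (Fin (2 * m))) S]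

namespace ReebCircleBundle

/-- `Θ` is a connection form on `Y`, regarded as the unit circle bundle of the normal bundle `N` of
`S`, with curvature `-K ωS`. The rotation of the fibres of `N` runs against the Reeb flow, so its
generator (of period one) is `-T₀ R`, and `Θ` takes the value one on it. Invariance of `Θ` under
the Reeb flow follows from the two equations. -/
structure IsConnectionForm (P : ReebCircleBundle m Y S) (K : ℝ)
    (Θ : ∀ y : Y, TangentSpace (𝓡 (2 * m + 1)) y →L[ℝ] ℝ) : Prop where
  smooth : SmoothOneForm Θ
  generator : ∀ y, Θ y (-(P.T₀ • P.R y)) = 1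
  curvature : ∀ y u v, extD Θ y u v =
    -K * P.ωS (P.proj y) (mfderiv (𝓡 (2 * m + 1)) (𝓡 (2 * m)) P.proj y u)
      (mfderiv (𝓡 (2 * m + 1)) (𝓡 (2 * m)) P.proj y v)

/-- `c₁(N) = [K ωS]` in de Rham cohomology, for the normal bundle `N` of `S`, whose unit circle
bundle is `Y`: by Chern-Weil theory, `K ωS` represents `c₁(N)` iff it is minus the curvature of a
connection form. -/
def IsNormalChernConstant (P : ReebCircleBundle m Y S) (K : ℝ) : Prop :=
  ∃ Θ, P.IsConnectionForm K Θ

/-- The form `-α / T₀` is a connection form, so `1 / T₀` is always such a constant. -/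
theorem isNormalChernConstant_inv (P : ReebCircleBundle m Y S) :
    P.IsNormalChernConstant (1 / P.T₀) := by
  refine ⟨fun y => (-(1 / P.T₀)) • P.α y, ?_, ?_, ?_⟩
  · intro x₀
    have := (P.α_smooth x₀).const_smul (-(1 / P.T₀))
    exact this
  · intro y
    have h0 := P.T₀_pos.ne'
    have : (P.α y) (-(P.T₀ • P.R y)) = -P.T₀ := by
      rw [map_neg, map_smul, P.α_R, smul_eq_mul, mul_one]
    change (-(1 / P.T₀)) * (P.α y) (-(P.T₀ • P.R y)) = 1
    rw [this]; field_simp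
  · intro y u v
    rw [P.ωS_proj]
    have key : ∀ a b : EuclideanSpace ℝ (Fin (2 * m + 1)),
        fderiv ℝ (fun e => chartRep (fun y => (-(1 / P.T₀)) • P.α y) y e a)
          (extChartAt (𝓡 (2 * m + 1)) y y) b
        = (-(1 / P.T₀)) * fderiv ℝ (fun e => chartRep P.α y e a)
          (extChartAt (𝓡 (2 * m + 1)) y y) b := by
      intro a b
      have h1 : (fun e => chartRep (fun y => (-(1 / P.T₀)) • P.α y) y e a)
          = (-(1 / P.T₀)) • fun e => chartRep P.α y e a := rfl
      rw [h1, fderiv_const_smul_field]; rfl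
    exact (congrArg₂ (· - ·) (key v u) (key u v)).trans (mul_sub _ _ _).symm

end ReebCircleBundle

/-! ### Almost complex structure and Hamiltonian on `ℝ × Y` -/

/-- The symplectic form `d(e^r α) = e^r (dr ∧ α + dα)` on `ℝ × Y` at `(r, y)`. -/
def sympForm (P : ReebCircleBundle m Y S) (r : ℝ) (y : Y)
    (u v : ℝ × TangentSpace (𝓡 (2 * m + 1)) y) : ℝ :=
  Real.exp r * (u.1 * P.α y v.2 - v.1 * P.α y u.2 + extD P.α y u.2 v.2)

/-- An endomorphism field of the bundle with fibres `ℝ ∂_r ⊕ T_y Y` over `Y` is smooth if it is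
smooth in charts. -/
def SmoothEndo (J : ∀ y : Y, (ℝ × TangentSpace (𝓡 (2 * m + 1)) y) →L[ℝ]
    (ℝ × TangentSpace (𝓡 (2 * m + 1)) y)) : Prop :=
  ∀ y₀ : Y, ∀ a : ℝ × EuclideanSpace ℝ (Fin (2 * m + 1)), ContDiffOn ℝ ∞
    (fun e : EuclideanSpace ℝ (Fin (2 * m + 1)) =>
      let y : Y := (extChartAt (𝓡 (2 * m + 1)) y₀).symm e
      let q : ℝ × TangentSpace (𝓡 (2 * m + 1)) y := J y (a.1, chartSymmDeriv y₀ e a.2)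
      ((q.1, mfderiv (𝓡 (2 * m + 1)) 𝓘(ℝ, EuclideanSpace ℝ (Fin (2 * m + 1)))
        (extChartAt (𝓡 (2 * m + 1)) y₀) y q.2) : ℝ × EuclideanSpace ℝ (Fin (2 * m + 1))))
    (extChartAt (𝓡 (2 * m + 1)) y₀).target

/-- Admissible almost complex structures on `ℝ × Y`: compatible with `d(e^r α)`, cylindrical and
Reeb-invariant. Being cylindrical includes invariance under translations of `ℝ`; for this reason
`J` is given as a family indexed by `y` alone, acting on `T_{(r,y)}(ℝ × Y) = ℝ ∂_r ⊕ T_y Y`. -/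
structure IsAdmissibleJ (P : ReebCircleBundle m Y S)
    (J : ∀ y : Y, (ℝ × TangentSpace (𝓡 (2 * m + 1)) y) →L[ℝ]
      (ℝ × TangentSpace (𝓡 (2 * m + 1)) y)) : Prop where
  smooth : SmoothEndo J
  sq : ∀ y u, J y (J y u) = -u
  symp : ∀ r y u v, sympForm P r y (J y u) (J y v) = sympForm P r y u v
  pos : ∀ r y u, u ≠ 0 → 0 < sympForm P r y u (J y u)
  J_dr : ∀ y, J y (1, 0) = (0, P.R y)
  J_ξ : ∀ y v, P.α y v = 0 → (J y (0, v)).1 = 0 ∧ P.α y (J y (0, v)).2 = 0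
  reeb_invariant : ∀ t y a v,
    J (P.flow t y) (a, mfderiv (𝓡 (2 * m + 1)) (𝓡 (2 * m + 1)) (P.flow t) y v) =
      ((J y (a, v)).1,
        mfderiv (𝓡 (2 * m + 1)) (𝓡 (2 * m + 1)) (P.flow t) y (J y (a, v)).2)

/-- The functions `h : (0, ∞) → ℝ` which define admissible Hamiltonians `H(r, y) = h(e^r)`. The
values of `h` outside `(0, ∞)` are irrelevant. -/
structure IsAdmissibleProfile (h : ℝ → ℝ) : Prop where
  smooth : ContDiffOn ℝ ∞ h (Ioi 0)
  zero : ∀ ρ, 0 < ρ → ρ ≤ 2 → h ρ = 0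
  deriv_pos : ∀ ρ, 2 < ρ → 0 < deriv h ρ
  deriv_tendsto : Tendsto (deriv h) atTop atTop
  deriv2_pos : ∀ ρ, 2 < ρ → 0 < deriv (deriv h) ρ

/-- The Hamiltonian vector field of `H(r, y) = h(e^r)` for the form `d(e^r α)`, namely
`h'(e^r) R`. -/
def hamVF (P : ReebCircleBundle m Y S) (h : ℝ → ℝ) (r : ℝ) (y : Y) :
    ℝ × TangentSpace (𝓡 (2 * m + 1)) y :=
  (0, deriv h (Real.exp r) • P.R y)

/-- A closed Reeb orbit of multiplicity `k ≥ 1`, parametrized by `ℝ/ℤ` with constant speed: it runs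
`k` times around a fibre, in the direction of the Reeb flow. -/
def IsReebOrbit (P : ReebCircleBundle m Y S) (k : ℕ) (γ : ℝ → Y) : Prop :=
  0 < k ∧ IsMIntegralCurve (I := 𝓡 (2 * m + 1)) γ (fun y => ((k : ℝ) * P.T₀) • P.R y)

/-- The loop `t ↦ (c, γ t)` is a nonconstant 1-periodic orbit of the Hamiltonian vector field, of
multiplicity `k ≥ 1`: it lies in the level `{b_k} × Y`, where `h'(e^{b_k}) = k T₀`. -/
def IsHamOrbit (P : ReebCircleBundle m Y S) (h : ℝ → ℝ) (k : ℕ) (c : ℝ) (γ : ℝ → Y) : Prop :=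
  0 < k ∧ deriv h (Real.exp c) = k * P.T₀ ∧ (∀ t, γ (t + 1) = γ t) ∧
    IsMIntegralCurve (I := 𝓡 (2 * m + 1)) γ (fun y => (hamVF P h c y).2)

/-! ### Punctured Floer cylinders -/

/-- The covering `ℝ × ℝ → ℝ × S¹`, with `S¹ = ℝ/ℤ`. -/
def cover (p : ℝ × ℝ) : ℝ × UnitAddCircle := (p.1, (p.2 : UnitAddCircle))

/-- The point `z + e^{2π(ρ + iθ)}` of the cylinder: conformal polar coordinates at `z`. -/
def aroundPuncture (z : ℝ × UnitAddCircle) (ρ θ : ℝ) : ℝ × UnitAddCircle :=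
  (z.1 + Real.exp (2 * Real.pi * ρ) * Real.cos (2 * Real.pi * θ),
    z.2 + ((Real.exp (2 * Real.pi * ρ) * Real.sin (2 * Real.pi * θ) : ℝ) : UnitAddCircle))

/-- The loops `g s : ℝ → Y` converge to `γ` in `C¹`, locally uniformly, as `s` tends to the
filter `l`. -/
def LoopsTendsto [IsManifold (𝓡 (2 * m + 1)) ∞ Y] (g : ℝ → ℝ → Y) (l : Filter ℝ) (γ : ℝ → Y) : Prop :=
  ∀ t₀ : ℝ, Tendsto
    (fun p : ℝ × ℝ => (⟨g p.1 p.2, mfderiv 𝓘(ℝ, ℝ) (𝓡 (2 * m + 1)) (g p.1) p.2 (1 : ℝ)⟩ :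
      TangentBundle (𝓡 (2 * m + 1)) Y))
    (l ×ˢ 𝓝 t₀)
    (𝓝 ⟨γ t₀, mfderiv 𝓘(ℝ, ℝ) (𝓡 (2 * m + 1)) γ t₀ (1 : ℝ)⟩)

/-- `ũ = (b, v) : ℝ × S¹ ∖ Γ → ℝ × Y` is a punctured Floer cylinder: a smooth solution of
`∂_s ũ + J(∂_t ũ - X_H(ũ)) = 0` which converges to a Hamiltonian orbit of multiplicity `kp` at `+∞`,
to a Hamiltonian orbit, or a Reeb orbit in `{-∞} × Y`, of multiplicity `km` at `-∞`, and to a Reeb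
orbit in `{-∞} × Y` of multiplicity `κ z` at each augmentation puncture `z ∈ Γ`. The values of `ũ`
on `Γ` and those of `κ` outside `Γ` are irrelevant. -/
structure IsPuncturedFloerCylinder [IsManifold (𝓡 (2 * m + 1)) ∞ Y] (P : ReebCircleBundle m Y S) (h : ℝ → ℝ)
    (J : ∀ y : Y, (ℝ × TangentSpace (𝓡 (2 * m + 1)) y) →L[ℝ]
      (ℝ × TangentSpace (𝓡 (2 * m + 1)) y))
    (Γ : Finset (ℝ × UnitAddCircle)) (b : ℝ × UnitAddCircle → ℝ) (v : ℝ × UnitAddCircle → Y)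
    (kp km : ℕ) (κ : ℝ × UnitAddCircle → ℕ) : Prop where
  smooth_b : ContDiffOn ℝ ∞ (fun p => b (cover p)) {p | cover p ∉ Γ}
  smooth_v : ContMDiffOn 𝓘(ℝ, ℝ × ℝ) (𝓡 (2 * m + 1)) ∞ (fun p => v (cover p)) {p | cover p ∉ Γ}
  floer : ∀ p : ℝ × ℝ, cover p ∉ Γ →
    ((fderiv ℝ (fun p => b (cover p)) p (1, 0),
        mfderiv 𝓘(ℝ, ℝ × ℝ) (𝓡 (2 * m + 1)) (fun p => v (cover p)) p ((1, 0) : ℝ × ℝ)) :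
        ℝ × TangentSpace (𝓡 (2 * m + 1)) (v (cover p))) +
      J (v (cover p))
        (((fderiv ℝ (fun p => b (cover p)) p (0, 1),
          mfderiv 𝓘(ℝ, ℝ × ℝ) (𝓡 (2 * m + 1)) (fun p => v (cover p)) p ((0, 1) : ℝ × ℝ)) :
          ℝ × TangentSpace (𝓡 (2 * m + 1)) (v (cover p))) -
          hamVF P h (b (cover p)) (v (cover p))) = 0
  plus_end : ∃ c γ, IsHamOrbit P h kp c γ ∧
    (∀ t₀, Tendsto (fun p => b (cover p)) (atTop ×ˢ 𝓝 t₀) (𝓝 c)) ∧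
    LoopsTendsto (m := m) (fun s t => v (cover (s, t))) atTop γ
  minus_end :
    (∃ c γ, IsHamOrbit P h km c γ ∧
      (∀ t₀, Tendsto (fun p => b (cover p)) (atBot ×ˢ 𝓝 t₀) (𝓝 c)) ∧
      LoopsTendsto (m := m) (fun s t => v (cover (s, t))) atBot γ) ∨
    (∃ γ, IsReebOrbit P km γ ∧
      (∀ t₀, Tendsto (fun p => b (cover p)) (atBot ×ˢ 𝓝 t₀) atBot) ∧
      LoopsTendsto (m := m) (fun s t => v (cover (s, t))) atBot γ)
  punctures : ∀ z ∈ Γ, ∃ γ, IsReebOrbit P (κ z) γ ∧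
    (∀ θ₀, Tendsto (fun q : ℝ × ℝ => b (aroundPuncture z q.1 q.2)) (atBot ×ˢ 𝓝 θ₀) atBot) ∧
    LoopsTendsto (m := m) (fun ρ θ => v (aroundPuncture z ρ θ)) atBot γ

/-! ### Spheres in the quotient -/

/-- The embedding `(s, t) ↦ e^{2π(s + it)}` of the cylinder in `ℂP¹ = ℂ ∪ {∞}`, lifted to
`ℝ × ℝ`. -/
def toSphere (p : ℝ × ℝ) : OnePoint ℂ :=
  ((Complex.exp (2 * Real.pi * (p.1 + p.2 * Complex.I)) : ℂ) : OnePoint ℂ)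

/-- `w : ℂP¹ → S` is the continuous extension of `proj ∘ ũ`. -/
def IsProjection (P : ReebCircleBundle m Y S) (Γ : Finset (ℝ × UnitAddCircle))
    (v : ℝ × UnitAddCircle → Y) (w : C(OnePoint ℂ, S)) : Prop :=
  ∀ p : ℝ × ℝ, cover p ∉ Γ → w (toSphere p) = P.proj (v (cover p))

/-- The density of `w^* ωS` in the affine coordinate `z = x + iy` of `ℂP¹`, that is,
`ωS(∂_x w, ∂_y w)`. -/
def areaDensity (P : ReebCircleBundle m Y S) (w : C(OnePoint ℂ, S)) (z : ℂ) : ℝ :=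
  P.ωS (w (z : OnePoint ℂ))
    (mfderiv 𝓘(ℝ, ℂ) (𝓡 (2 * m)) (fun z : ℂ => w (z : OnePoint ℂ)) z (1 : ℂ))
    (mfderiv 𝓘(ℝ, ℂ) (𝓡 (2 * m)) (fun z : ℂ => w (z : OnePoint ℂ)) z Complex.I)

/-- `ω(A) = ∫_{ℂP¹} w^* ωS` for `A = [w]`, computed in the affine coordinate. -/
def symplecticArea (P : ReebCircleBundle m Y S) (w : C(OnePoint ℂ, S)) : ℝ :=
  ∫ z : ℂ, areaDensity P w z

end

/-- Singular homology `H₂(X; ℤ)`. -/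
def H2 (X : Type) [TopologicalSpace X] : ModuleCat.{0} ℤ :=
  ((AlgebraicTopology.singularHomologyFunctor (ModuleCat.{0} ℤ) 2).obj (ModuleCat.of ℤ ℤ)).obj
    (TopCat.of X)

/-- The map induced on `H₂(-; ℤ)` by a continuous map. -/
def H2map {X X' : Type} [TopologicalSpace X] [TopologicalSpace X'] (f : C(X, X')) :
    H2 X →ₗ[ℤ] H2 X' :=
  (((AlgebraicTopology.singularHomologyFunctor (ModuleCat.{0} ℤ) 2).obj
    (ModuleCat.of ℤ ℤ)).map (TopCat.ofHom f)).hom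

end SplitFloer

end

/-!
The identity is Stokes' theorem for the connection form `Θ`. In the coordinate
`z = e^{2π(s + it)}` the domain of the Floer cylinder is the plane `ℂ` without `0` and the
augmentation punctures, and its `Y`-component is a map `u` from there to `Y`. The 1-form
`β = -u^*Θ` satisfies `dβ = K w^*ωS` (`planeExtD_planeForm`), by the curvature equation and the
compatibility of the exterior derivative with pullbacks (`fderiv_pullback_sub`). Since `-Θ` takes the
value `1` on `T₀ R`, the integral of `β` over a loop which is `C¹`-close to a `k`-fold fibre is close
to `k`; the multiplicities are therefore the fluxes of `β` at the punctures and at `∞`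
(`hasFlux_plus`, `hasFlux_minus`, `hasFlux_puncture`).

Fluxes are measured by cutoff functions `ψ` concentrating at a puncture: they are limits of
`∫ dψ ∧ β`. The cutoff functions are radial in a conformal coordinate centred at the puncture, so that
only the angular component of `β` in that coordinate enters; this is the component which is
controlled by the `C¹` convergence of loops (`hasFlux_infty`, `hasFlux_of_chart`). With `χ` one minus
the sum of the cutoff functions, `0 = ∫ d(χβ)` gives `∫ χ dβ = ∑ ∫ dψ ∧ β`. As `dβ ≥ 0`, Fatou's lemma
shows that `dβ` is integrable, and dominated convergence evaluates its integral
(`integral_planeExtD_eq_sum_flux`).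

The density of `w^*ωS` is nonnegative because Floer's equation says that the contact components
`ξ_s`, `ξ_t` of the derivatives of the `Y`-component satisfy `ξ_t = J ξ_s`, and `J` is tamed by `dα`
on the contact hyperplanes (`ωS_nonneg_of_floer`). The density vanishes only where `dw = 0`. Hence a
sphere of area zero is constant (`const_of_symplecticArea_eq_zero`) and represents the zero class,
which gives the strict inequality when `A ≠ 0`; when there are augmentation punctures, it holds
because their multiplicities are positive.
-/

noncomputable section

namespace SplitFloer

/-! ### Stokes' theorem on the punctured plane -/

/-- The value of `a ∧ b` on the oriented basis `1, i` of `ℂ`. -/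
def wedge (a b : ℂ →L[ℝ] ℝ) : ℝ := a 1 * b Complex.I - a Complex.I * b 1

/-- The value of `dβ` on the oriented basis `1, i` of `ℂ`. -/
def planeExtD (β : ℂ → ℂ →L[ℝ] ℝ) (z : ℂ) : ℝ :=
  fderiv ℝ β z 1 Complex.I - fderiv ℝ β z Complex.I 1

/-- The neighbourhoods of a point of `ℂP¹`, intersected with `ℂ`. -/
def endNhds (x : OnePoint ℂ) : Filter ℂ := comap (↑) (𝓝 x)

theorem endNhds_coe (z : ℂ) : endNhds (z : OnePoint ℂ) = 𝓝 z := OnePoint.comap_coe_nhds z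

theorem endNhds_infty : endNhds OnePoint.infty = cocompact ℂ := by
  rw [endNhds, OnePoint.comap_coe_nhds_infty, coclosedCompact_eq_cocompact]

/-- A sequence of functions on `ℂ`, eventually `C¹`, with values in `[0, 1]`, each one eventually
equal to `1` near the point `x` of `ℂP¹`, whose supports shrink to `x`. -/
structure IsCutoffSeq (ψ : ℕ → ℂ → ℝ) (x : OnePoint ℂ) : Prop where
  contDiff : ∀ᶠ N in atTop, ContDiff ℝ 1 (ψ N)
  nonneg : ∀ N z, 0 ≤ ψ N z
  le_one : ∀ N z, ψ N z ≤ 1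
  eq_one : ∀ᶠ N in atTop, ∀ᶠ z in endNhds x, ψ N z = 1
  support : ∀ V ∈ 𝓝 x, ∀ᶠ N in atTop, ∀ z : ℂ, ψ N z ≠ 0 → (z : OnePoint ℂ) ∈ V

/-- The flux of the 1-form `β` out of the point `x` of `ℂP¹` is `φ`: the integrals of `dψ ∧ β` tend
to `φ` along some sequence of cutoff functions `ψ` concentrating at `x`. For `x = ∞` this is the
limit of the integrals of `β` over large circles, for `x ∈ ℂ` it is minus the limit of its integrals
over small loops around `x`. -/
def HasFlux (β : ℂ → ℂ →L[ℝ] ℝ) (x : OnePoint ℂ) (φ : ℝ) : Prop :=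
  ∃ ψ : ℕ → ℂ → ℝ, IsCutoffSeq ψ x ∧
    Tendsto (fun N => ∫ z, wedge (fderiv ℝ (ψ N) z) (β z)) atTop (𝓝 φ)

theorem wedge_neg_sum {ι : Type*} (s : Finset ι) (a : ι → ℂ →L[ℝ] ℝ) (b : ℂ →L[ℝ] ℝ) :
    wedge (-∑ i ∈ s, a i) b = -∑ i ∈ s, wedge (a i) b := by
  simp only [wedge, neg_apply, sum_apply, Finset.sum_sub_distrib, ← Finset.sum_mul]
  ring

theorem hasCompactSupport_of_eventually {E : Type*} [Zero E] {g : ℂ → E}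
    (h : ∀ᶠ z in endNhds OnePoint.infty, g z = 0) : HasCompactSupport g := by
  rw [hasCompactSupport_iff_eventuallyEq, coclosedCompact_eq_cocompact]
  rwa [endNhds_infty] at h

/-- The integral over the plane of a directional derivative of a compactly supported function
vanishes. -/
theorem integral_fderiv_apply_eq_zero {g : ℂ → ℝ} (hg : ContDiff ℝ 1 g) (hc : HasCompactSupport g)
    (v : ℂ) : ∫ z, fderiv ℝ g z v = 0 := by
  have hi : Integrable (fun z => fderiv ℝ g z v) :=
    ((hg.continuous_fderiv one_ne_zero).clm_apply continuous_const).integrable_of_hasCompactSupport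
      (hc.fderiv_apply (𝕜 := ℝ) v)
  have := integral_mul_fderiv_eq_neg_fderiv_mul_of_integrable (μ := (volume : Measure ℂ))
    (f := fun _ : ℂ => (1 : ℝ)) (g := g) (v := v) (by simp) (by simpa using hi)
    (by simpa using hg.continuous.integrable_of_hasCompactSupport hc)
    (fun x _ => differentiableAt_const _) (fun x _ => hg.differentiable one_ne_zero x)
  simpa using this

/-- Stokes' theorem for compactly supported 1-forms on the plane. -/
theorem integral_planeExtD_eq_zero {β : ℂ → ℂ →L[ℝ] ℝ} (hβ : ContDiff ℝ 1 β)
    (hc : HasCompactSupport β) : ∫ z, planeExtD β z = 0 := by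
  have key : ∀ v w : ℂ, ∫ z, fderiv ℝ β z v w = 0 ∧ Integrable (fun z => fderiv ℝ β z v w) := by
    intro v w
    have h1 : ContDiff ℝ 1 (fun z => β z w) := hβ.clm_apply contDiff_const
    have h2 : HasCompactSupport (fun z => β z w) := by
      refine hc.comp_left (g := fun L : ℂ →L[ℝ] ℝ => L w) ?_
      simp
    have h3 : ∀ z, fderiv ℝ (fun z => β z w) z v = fderiv ℝ β z v w := by
      intro z
      rw [fderiv_clm_apply (hβ.differentiable one_ne_zero z) (differentiableAt_const w)]
      simp
    have h4 := integral_fderiv_apply_eq_zero h1 h2 v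
    simp only [h3] at h4
    refine ⟨h4, ?_⟩
    have := ((h1.continuous_fderiv one_ne_zero).clm_apply
      (continuous_const (y := v))).integrable_of_hasCompactSupport (μ := volume)
      (h2.fderiv_apply (𝕜 := ℝ) v)
    simpa only [h3] using this
  unfold planeExtD
  rw [integral_sub (key _ _).2 (key _ _).2, (key _ _).1, (key _ _).1, sub_zero]

theorem planeExtD_smul {χ : ℂ → ℝ} {β : ℂ → ℂ →L[ℝ] ℝ} {z : ℂ} (hχ : DifferentiableAt ℝ χ z)
    (hβ : DifferentiableAt ℝ β z) :
    planeExtD (fun z => χ z • β z) z = wedge (fderiv ℝ χ z) (β z) + χ z * planeExtD β z := by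
  simp only [planeExtD, wedge]
  rw [fderiv_fun_smul hχ hβ]
  simp
  ring

/-- Integrals of pointwise convergent nonnegative functions which are dominated by their limit and
whose integrals converge. -/
theorem integrable_and_integral_eq_of_tendsto {f : ℂ → ℝ} {F : ℕ → ℂ → ℝ} {L : ℝ}
    (hF : ∀ᶠ N in atTop, Integrable (F N) ∧ (∀ᵐ z, 0 ≤ F N z) ∧ ∀ᵐ z, F N z ≤ f z)
    (hlim : ∀ᵐ z, Tendsto (fun N => F N z) atTop (𝓝 (f z)))
    (hL : Tendsto (fun N => ∫ z, F N z) atTop (𝓝 L)) :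
    Integrable f ∧ ∫ z, f z = L := by
  obtain ⟨N₀, hN₀⟩ := eventually_atTop.1 hF
  have hF' : ∀ n, Integrable (F (n + N₀)) ∧ (∀ᵐ z, 0 ≤ F (n + N₀) z) ∧ ∀ᵐ z, F (n + N₀) z ≤ f z :=
    fun n => hN₀ _ (Nat.le_add_left _ _)
  have hlim' : ∀ᵐ z, Tendsto (fun n => F (n + N₀) z) atTop (𝓝 (f z)) := by
    filter_upwards [hlim] with z hz using hz.comp (tendsto_add_atTop_nat N₀)
  have hL' : Tendsto (fun n => ∫ z, F (n + N₀) z) atTop (𝓝 L) := hL.comp (tendsto_add_atTop_nat N₀)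
  have hmeas : AEStronglyMeasurable f volume :=
    aestronglyMeasurable_of_tendsto_ae atTop (fun n => (hF' n).1.aestronglyMeasurable) hlim'
  have hint : Integrable f := by
    refine ⟨hmeas, lt_of_le_of_lt (le_of_eq_of_le (lintegral_congr_ae (by
      filter_upwards [hlim'] with z hz using hz.enorm.liminf_eq.symm)) (lintegral_liminf_le'
      (fun n => (hF' n).1.aestronglyMeasurable.aemeasurable.enorm))) ?_⟩
    have : ∀ n, ∫⁻ z, ‖F (n + N₀) z‖ₑ = ENNReal.ofReal (∫ z, F (n + N₀) z) := by
      intro n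
      rw [ofReal_integral_eq_lintegral_ofReal (hF' n).1 (hF' n).2.1]
      refine lintegral_congr_ae ?_
      filter_upwards [(hF' n).2.1] with z hz
      exact Real.enorm_of_nonneg hz
    simp only [this]
    exact ((ENNReal.continuous_ofReal.tendsto L).comp hL').liminf_eq.trans_lt ENNReal.ofReal_lt_top
  refine ⟨hint, tendsto_nhds_unique ?_ hL'⟩
  refine tendsto_integral_of_dominated_convergence f
    (fun n => (hF' n).1.aestronglyMeasurable) hint (fun n => ?_) hlim'
  filter_upwards [(hF' n).2.1, (hF' n).2.2] with z h0 h1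
  rwa [Real.norm_of_nonneg h0]

section Ends

variable {ι : Type*} {e : ι → OnePoint ℂ}

theorem ae_notMem_range [Finite ι] (e : ι → OnePoint ℂ) : ∀ᵐ z : ℂ, (z : OnePoint ℂ) ∉ range e :=
  measure_eq_zero_iff_ae_notMem.1
    (((finite_range e).preimage OnePoint.coe_injective.injOn).measure_zero volume)

/-- A function which is `Cⁿ` off the ends and vanishes near them is `Cⁿ`. -/
theorem contDiff_of_vanish_near_ends {n : WithTop ℕ∞} {E : Type*} [NormedAddCommGroup E]
    [NormedSpace ℝ E] {g : ℂ → E}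
    (hg : ∀ z : ℂ, (z : OnePoint ℂ) ∉ range e → ContDiffAt ℝ n g z)
    (h0 : ∀ i, ∀ᶠ z in endNhds (e i), g z = 0) :
    ContDiff ℝ n g := by
  rw [contDiff_iff_contDiffAt]
  intro z
  by_cases hz : (z : OnePoint ℂ) ∈ range e
  · obtain ⟨i, hi⟩ := hz
    have := h0 i
    rw [hi, endNhds_coe] at this
    exact (contDiffAt_const (c := (0 : E))).congr_of_eventuallyEq this
  · exact hg z hz

theorem integrable_of_vanish_near_ends {g : ℂ → ℝ} (hinf : OnePoint.infty ∈ range e)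
    (hg : ∀ z : ℂ, (z : OnePoint ℂ) ∉ range e → ContinuousAt g z)
    (h0 : ∀ i, ∀ᶠ z in endNhds (e i), g z = 0) :
    Integrable g := by
  have hc : Continuous g := by
    rw [continuous_iff_continuousAt]
    intro z
    by_cases hz : (z : OnePoint ℂ) ∈ range e
    · obtain ⟨i, hi⟩ := hz
      have := h0 i
      rw [hi, endNhds_coe] at this
      exact continuousAt_const.congr (EventuallyEq.symm this)
    · exact hg z hz
  obtain ⟨i, hi⟩ := hinf
  exact hc.integrable_of_hasCompactSupport (hasCompactSupport_of_eventually (hi ▸ h0 i))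

theorem fderiv_eventually_zero {g : ℂ → ℝ} {x : OnePoint ℂ} {c : ℝ}
    (h : ∀ᶠ z in endNhds x, g z = c) : ∀ᶠ z in endNhds x, fderiv ℝ g z = 0 := by
  have h2 : ∀ᶠ z in endNhds x, ∀ᶠ z' in 𝓝 z, g z' = c := by
    rw [endNhds, eventually_comap] at h ⊢
    filter_upwards [eventually_eventually_nhds.2 h] with y hy z hz
    subst hz
    have := OnePoint.continuous_coe.continuousAt.eventually hy
    filter_upwards [this] with z' hz' using hz' z' rfl
  filter_upwards [h2] with z hz
  rw [Filter.EventuallyEq.fderiv_eq (f := fun _ => c) hz]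
  simp

/-- Stokes' theorem on a punctured plane, for a 1-form whose exterior derivative is nonnegative: if
the fluxes at all punctures, including the one at `∞`, exist, then the exterior derivative is
integrable, and its integral is the sum of the fluxes. -/
theorem integral_planeExtD_eq_sum_flux [Fintype ι] (he : Function.Injective e)
    (hinf : OnePoint.infty ∈ range e) {β : ℂ → ℂ →L[ℝ] ℝ}
    (hβ : ∀ z : ℂ, (z : OnePoint ℂ) ∉ range e → ContDiffAt ℝ 1 β z)
    (hpos : ∀ z : ℂ, (z : OnePoint ℂ) ∉ range e → 0 ≤ planeExtD β z)
    {φ : ι → ℝ} (hflux : ∀ i, HasFlux β (e i) (φ i)) :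
    Integrable (planeExtD β) ∧ ∫ z, planeExtD β z = ∑ i, φ i := by
  classical
  choose ψ hψ hlim using hflux
  obtain ⟨V, hV, hdisj⟩ := (finite_range e).t2_separation
  have hae : ∀ᵐ z : ℂ, (z : OnePoint ℂ) ∉ range e :=
    ae_notMem_range e
  have hdisj' : ∀ i j, i ≠ j → ∀ y, y ∈ V (e i) → y ∉ V (e j) := fun i j hij y hy hy' =>
    Set.disjoint_left.1 (hdisj (mem_range_self i) (mem_range_self j) (he.ne hij)) hy hy'
  set χ : ℕ → ℂ → ℝ := fun N z => 1 - ∑ i, ψ i N z with hχ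
  -- For large `N` the supports of the cutoff functions are disjoint.
  have hN : ∀ᶠ N in atTop, ∀ i, ContDiff ℝ 1 (ψ i N) ∧ (∀ᶠ z in endNhds (e i), ψ i N z = 1) ∧
      ∀ z : ℂ, ψ i N z ≠ 0 → (z : OnePoint ℂ) ∈ V (e i) :=
    eventually_all.2 fun i => (hψ i).contDiff.and ((hψ i).eq_one.and
      ((hψ i).support _ ((hV (e i)).2.mem_nhds (hV (e i)).1)))
  have hzero : ∀ N, (∀ i, ∀ z : ℂ, ψ i N z ≠ 0 → (z : OnePoint ℂ) ∈ V (e i)) →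
      ∀ i (z : ℂ), (z : OnePoint ℂ) ∈ V (e i) → ∀ j, j ≠ i → ψ j N z = 0 := by
    intro N h i z hz j hj
    by_contra hne
    exact hdisj' j i hj _ (h j z hne) hz
  have hVend : ∀ i, ∀ᶠ z in endNhds (e i), ((z : ℂ) : OnePoint ℂ) ∈ V (e i) := fun i =>
    preimage_mem_comap ((hV (e i)).2.mem_nhds (hV (e i)).1)
  -- Hence `χ N` vanishes near all ends, and has values in `[0, 1]`.
  have hχ0 : ∀ᶠ N in atTop, ∀ i, ∀ᶠ z in endNhds (e i), χ N z = 0 := by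
    filter_upwards [hN] with N h i
    filter_upwards [(h i).2.1, hVend i] with z h1 h2
    simp only [hχ]
    rw [Finset.sum_eq_single i (fun j _ hj => hzero N (fun i => (h i).2.2) i z h2 j hj) (by simp),
      h1, sub_self]
  have hχ01 : ∀ᶠ N in atTop, ∀ z, 0 ≤ χ N z ∧ χ N z ≤ 1 := by
    filter_upwards [hN] with N h z
    refine ⟨?_, by simpa [hχ] using Finset.sum_nonneg fun i _ => (hψ i).nonneg N z⟩
    simp only [hχ, sub_nonneg]
    by_cases hz : ∃ i, (z : OnePoint ℂ) ∈ V (e i)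
    · obtain ⟨i, hi⟩ := hz
      rw [Finset.sum_eq_single i (fun j _ hj => hzero N (fun i => (h i).2.2) i z hi j hj) (by simp)]
      exact (hψ i).le_one N z
    · push Not at hz
      rw [Finset.sum_eq_zero fun i _ => by_contra fun hne => hz i ((h i).2.2 z hne)]
      exact zero_le_one
  have hχ1 : ∀ z : ℂ, (z : OnePoint ℂ) ∉ range e → ∀ᶠ N in atTop, χ N z = 1 := by
    intro z hz
    have : ∀ᶠ N in atTop, ∀ i, ψ i N z = 0 := by
      refine eventually_all.2 fun i => ?_
      have hne : e i ≠ z := fun h => hz ⟨i, h⟩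
      filter_upwards [(hψ i).support _ (isOpen_compl_singleton.mem_nhds hne)] with N h
      by_contra h0
      exact h z h0 rfl
    filter_upwards [this] with N h
    simp [hχ, h]
  have hψ0 : ∀ᶠ N in atTop, ∀ i j, ∀ᶠ z in endNhds (e j), fderiv ℝ (ψ i N) z = 0 := by
    filter_upwards [hN] with N h i j
    rcases eq_or_ne i j with rfl | hij
    · exact fderiv_eventually_zero (h i).2.1
    · refine fderiv_eventually_zero (c := 0) ?_
      filter_upwards [hVend j] with z hz
      exact hzero N (fun i => (h i).2.2) j z hz i hij
  have hχint : ∀ᶠ N in atTop, Integrable fun z => χ N z * planeExtD β z := by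
    filter_upwards [hN, hχ0] with N h h0
    have hχC : ContDiff ℝ 1 (χ N) := contDiff_const.sub (ContDiff.sum fun i _ => (h i).1)
    refine integrable_of_vanish_near_ends hinf (fun z hz => ?_) fun i => ?_
    · have h1 : ContinuousAt (fderiv ℝ β) z := ((hβ z hz).fderiv_right (m := 0) le_rfl).continuousAt
      exact hχC.continuous.continuousAt.mul
        (((h1.clm_apply continuousAt_const).clm_apply continuousAt_const).sub
          ((h1.clm_apply continuousAt_const).clm_apply continuousAt_const))
    · filter_upwards [h0 i] with z hz
      rw [hz, zero_mul]
  refine integrable_and_integral_eq_of_tendsto (F := fun N z => χ N z * planeExtD β z) ?_ ?_ ?_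
  · filter_upwards [hχint, hχ01] with N h1 h2
    refine ⟨h1, ?_, ?_⟩
    · filter_upwards [hae] with z hz using mul_nonneg (h2 z).1 (hpos z hz)
    · filter_upwards [hae] with z hz using mul_le_of_le_one_left (hpos z hz) (h2 z).2
  · filter_upwards [hae] with z hz
    refine tendsto_const_nhds.congr' ?_
    filter_upwards [hχ1 z hz] with N h
    rw [h, one_mul]
  · refine (tendsto_finsetSum Finset.univ fun i _ => hlim i).congr' ?_
    filter_upwards [hN, hχ0, hψ0, hχint] with N h hχ0 hψ0 hχint
    have hχC : ContDiff ℝ 1 (χ N) := contDiff_const.sub (ContDiff.sum fun i _ => (h i).1)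
    have hdχ : ∀ z, fderiv ℝ (χ N) z = -∑ i, fderiv ℝ (ψ i N) z := by
      intro z
      simp only [hχ]
      rw [fderiv_const_sub,
        fderiv_fun_sum fun i _ => ((h i).1.differentiable one_ne_zero) z]
    have hC : ContDiff ℝ 1 fun z => χ N z • β z := by
      refine contDiff_of_vanish_near_ends (fun z hz => hχC.contDiffAt.smul (hβ z hz)) fun i => ?_
      filter_upwards [hχ0 i] with z hz
      rw [hz, zero_smul]
    have hcpt : HasCompactSupport fun z => χ N z • β z := by
      obtain ⟨i, hi⟩ := hinf
      refine hasCompactSupport_of_eventually ?_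
      filter_upwards [hi ▸ hχ0 i] with z hz
      rw [hz, zero_smul]
    have hint : ∀ i, Integrable fun z => wedge (fderiv ℝ (ψ i N) z) (β z) := by
      intro i
      refine integrable_of_vanish_near_ends hinf (fun z hz => ?_) fun j => ?_
      · have h1 := ((h i).1.continuous_fderiv one_ne_zero).continuousAt (x := z)
        have h2 := (hβ z hz).continuousAt
        exact ((h1.clm_apply continuousAt_const).mul (h2.clm_apply continuousAt_const)).sub
          ((h1.clm_apply continuousAt_const).mul (h2.clm_apply continuousAt_const))
      · filter_upwards [hψ0 i j] with z hz
        simp [hz, wedge]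
    have h0 := integral_planeExtD_eq_zero hC hcpt
    have h1 : ∫ z, planeExtD (fun z => χ N z • β z) z =
        ∫ z, ((χ N z * planeExtD β z) - ∑ i, wedge (fderiv ℝ (ψ i N) z) (β z)) := by
      refine integral_congr_ae ?_
      filter_upwards [hae] with z hz
      rw [planeExtD_smul (hχC.differentiable one_ne_zero z)
        ((hβ z hz).differentiableAt one_ne_zero), hdχ, wedge_neg_sum]
      ring
    rw [h0, integral_sub hχint (integrable_finsetSum _ fun i _ => hint i),
      integral_finsetSum _ fun i _ => hint i] at h1
    linarith

end Ends

/-! ### Radial cutoff functions -/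

/-- The function of `‖z‖` which is `1` where `a ‖z‖² ≤ 1` and `0` where `a ‖z‖² ≥ 2`. -/
def radialCutoff (a : ℝ) (z : ℂ) : ℝ := Real.smoothTransition (2 - a * ‖z‖ ^ 2)

/-- The radial kernel `k` with `d(radialCutoff a) = -k(z) ⟨z, ·⟩`. -/
def radialKernel (a : ℝ) (z : ℂ) : ℝ := 2 * a * deriv Real.smoothTransition (2 - a * ‖z‖ ^ 2)

theorem contDiff_radialCutoff (a : ℝ) : ContDiff ℝ 1 (radialCutoff a) :=
  (Real.smoothTransition.contDiff (n := 1)).comp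
    (contDiff_const.sub (contDiff_const.mul (contDiff_norm_sq ℝ)))

theorem hasDerivAt_smoothTransition (x : ℝ) :
    HasDerivAt Real.smoothTransition (deriv Real.smoothTransition x) x :=
  ((Real.smoothTransition.contDiff (n := 1)).differentiable one_ne_zero x).hasDerivAt

theorem deriv_smoothTransition_eq_zero {x : ℝ} (hx : x < 0 ∨ 1 < x) :
    deriv Real.smoothTransition x = 0 := by
  rcases hx with hx | hx
  · have : Real.smoothTransition =ᶠ[𝓝 x] fun _ => 0 := by
      filter_upwards [gt_mem_nhds hx] with y hy using Real.smoothTransition.zero_of_nonpos hy.le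
    rw [this.deriv_eq, deriv_const]
  · have : Real.smoothTransition =ᶠ[𝓝 x] fun _ => 1 := by
      filter_upwards [lt_mem_nhds hx] with y hy using Real.smoothTransition.one_of_one_le hy.le
    rw [this.deriv_eq, deriv_const]

theorem fderiv_radialCutoff (a : ℝ) (z v : ℂ) :
    fderiv ℝ (radialCutoff a) z v = -radialKernel a z * inner ℝ z v := by
  have h1 : HasFDerivAt (fun z : ℂ => 2 - a * ‖z‖ ^ 2) (-(a • (2 • innerSL ℝ z))) z :=
    (((hasStrictFDerivAt_norm_sq z).hasFDerivAt).const_mul a).const_sub 2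
  have h2 := (hasDerivAt_smoothTransition (2 - a * ‖z‖ ^ 2)).comp_hasFDerivAt z h1
  have h3 : HasFDerivAt (radialCutoff a) _ z := h2
  rw [h3.fderiv, radialKernel]
  simp
  ring

theorem wedge_fderiv_radialCutoff (a : ℝ) (z : ℂ) (b : ℂ →L[ℝ] ℝ) :
    wedge (fderiv ℝ (radialCutoff a) z) b = -(radialKernel a z * b (Complex.I * z)) := by
  have h : Complex.I * z = (-z.im) • (1 : ℂ) + z.re • Complex.I := by
    apply Complex.ext <;> simp
  rw [h, map_add, map_smul, map_smul, wedge, fderiv_radialCutoff, fderiv_radialCutoff]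
  simp [Complex.inner]
  ring

theorem radialKernel_nonneg {a : ℝ} (ha : 0 ≤ a) (z : ℂ) : 0 ≤ radialKernel a z :=
  mul_nonneg (mul_nonneg zero_le_two ha) Real.smoothTransition.monotone.deriv_nonneg

theorem radialKernel_ne_zero {a : ℝ} {z : ℂ} (h : radialKernel a z ≠ 0) :
    1 ≤ a * ‖z‖ ^ 2 ∧ a * ‖z‖ ^ 2 ≤ 2 := by
  by_contra hc
  refine h ?_
  rw [radialKernel, deriv_smoothTransition_eq_zero, mul_zero]
  by_contra h2
  push Not at h2
  exact hc ⟨by linarith [h2.2], by linarith [h2.1]⟩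

theorem continuous_radialKernel (a : ℝ) : Continuous (radialKernel a) :=
  continuous_const.mul (((Real.smoothTransition.contDiff (n := 1)).continuous_deriv le_rfl).comp
    (continuous_const.sub (continuous_const.mul (continuous_norm.pow 2))))

theorem radialCutoff_eq_zero {a : ℝ} {z : ℂ} (h : 2 ≤ a * ‖z‖ ^ 2) : radialCutoff a z = 0 :=
  Real.smoothTransition.zero_of_nonpos (by linarith)

theorem radialCutoff_eq_one {a : ℝ} {z : ℂ} (h : a * ‖z‖ ^ 2 ≤ 1) : radialCutoff a z = 1 :=
  Real.smoothTransition.one_of_one_le (by linarith)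

theorem isCompact_annulus {a : ℝ} (ha : 0 < a) :
    IsCompact {z : ℂ | 1 ≤ a * ‖z‖ ^ 2 ∧ a * ‖z‖ ^ 2 ≤ 2} := by
  refine Metric.isCompact_of_isClosed_isBounded ?_ ?_
  · have : Continuous fun z : ℂ => a * ‖z‖ ^ 2 := continuous_const.mul (continuous_norm.pow 2)
    exact (isClosed_le continuous_const this).inter (isClosed_le this continuous_const)
  · refine isBounded_iff_forall_norm_le.2 ⟨1 + 2 / a, fun z hz => ?_⟩
    have h1 : ‖z‖ ^ 2 ≤ 2 / a := by
      rw [le_div_iff₀ ha]; linarith [hz.2]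
    nlinarith [sq_nonneg (‖z‖ - 1), norm_nonneg z]

theorem integrable_radialKernel_mul {a : ℝ} (ha : 0 < a) {c : ℂ → ℝ}
    (hc : ContinuousOn c {z : ℂ | 1 ≤ a * ‖z‖ ^ 2 ∧ a * ‖z‖ ^ 2 ≤ 2}) :
    Integrable fun z => radialKernel a z * c z := by
  have h1 := ((continuous_radialKernel a).continuousOn.mul hc).integrableOn_compact (μ := volume)
    (isCompact_annulus ha)
  rwa [integrableOn_iff_integrable_of_support_subset] at h1
  intro z hz
  exact radialKernel_ne_zero (left_ne_zero_of_mul hz)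

theorem integral_radialKernel {a : ℝ} (ha : 0 < a) : ∫ z, radialKernel a z = 2 * Real.pi := by
  rw [← Complex.integral_comp_polarCoord_symm]
  have h1 : ∀ r : ℝ, HasDerivAt (fun r => -Real.smoothTransition (2 - a * r ^ 2))
      (r * (2 * a * deriv Real.smoothTransition (2 - a * r ^ 2))) r := by
    intro r
    have h2 : HasDerivAt (fun r : ℝ => 2 - a * r ^ 2) (-(a * (2 * r))) r := by
      simpa using ((hasDerivAt_pow 2 r).const_mul a).const_sub 2
    have h3 := ((hasDerivAt_smoothTransition (2 - a * r ^ 2)).comp r h2).neg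
    exact h3.congr_deriv (by ring)
  have hzero : ∀ r : ℝ, 0 < r → 2 + 2 / a < r → 2 - a * r ^ 2 ≤ 0 := by
    intro r hr h
    have h3 : 2 * a + 2 < a * r := by
      have := mul_lt_mul_of_pos_left h ha
      rw [mul_add, mul_div_cancel₀ _ ha.ne'] at this
      linarith
    nlinarith [div_pos two_pos ha]
  have h4 : Integrable (fun r : ℝ => r * (2 * a * deriv Real.smoothTransition (2 - a * r ^ 2)))
      (volume.restrict (Ioi 0)) := by
    refine integrableOn_Ioi_deriv_of_nonneg' (g := fun r => -Real.smoothTransition (2 - a * r ^ 2))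
      (l := 0) (fun r _ => h1 r) (fun r hr => ?_) ?_
    · exact mul_nonneg (le_of_lt hr) (mul_nonneg (by positivity)
        Real.smoothTransition.monotone.deriv_nonneg)
    · refine tendsto_const_nhds.congr' ?_
      filter_upwards [eventually_gt_atTop 0, eventually_gt_atTop (2 + 2 / a)] with r h0 h
      rw [Real.smoothTransition.zero_of_nonpos (hzero r h0 h), neg_zero]
  have h5 : ∫ r in Ioi (0 : ℝ), r * (2 * a * deriv Real.smoothTransition (2 - a * r ^ 2)) = 1 := by
    rw [integral_Ioi_of_hasDerivAt_of_tendsto (m := 0) (h1 0).continuousAt.continuousWithinAt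
      (fun r _ => h1 r) h4]
    · norm_num [Real.smoothTransition.one_of_one_le]
    · refine tendsto_const_nhds.congr' ?_
      filter_upwards [eventually_gt_atTop 0, eventually_gt_atTop (2 + 2 / a)] with r h0 h
      rw [Real.smoothTransition.zero_of_nonpos (hzero r h0 h), neg_zero]
  have h6 : ∀ p ∈ polarCoord.target, p.1 • radialKernel a (Complex.polarCoord.symm p) =
      (p.1 * (2 * a * deriv Real.smoothTransition (2 - a * p.1 ^ 2))) * 1 := by
    intro p hp
    rw [radialKernel, Complex.norm_polarCoord_symm, sq_abs, smul_eq_mul, mul_one]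
  rw [setIntegral_congr_fun polarCoord.open_target.measurableSet h6, polarCoord_target,
    Measure.volume_eq_prod, setIntegral_prod_mul
      (fun r : ℝ => r * (2 * a * deriv Real.smoothTransition (2 - a * r ^ 2))) (fun _ => (1 : ℝ)), h5]
  simp [Real.pi_pos.le]
  ring

/-- The kernels `radialKernel a / 2π` form an approximate identity in the radial variable. -/
theorem tendsto_integral_radialKernel_mul {a : ℕ → ℝ} {c : ℂ → ℝ} {ℓ : ℝ}
    (ha : ∀ᶠ N in atTop, 0 < a N)
    (hcont : ∀ᶠ N in atTop, ContinuousOn c {z : ℂ | 1 ≤ a N * ‖z‖ ^ 2 ∧ a N * ‖z‖ ^ 2 ≤ 2})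
    (hc : ∀ ε > 0, ∀ᶠ N in atTop, ∀ z : ℂ, 1 ≤ a N * ‖z‖ ^ 2 → a N * ‖z‖ ^ 2 ≤ 2 → |c z - ℓ| ≤ ε) :
    Tendsto (fun N => ∫ z, radialKernel (a N) z * c z) atTop (𝓝 (2 * Real.pi * ℓ)) := by
  rw [Metric.tendsto_nhds]
  intro ε hε
  have hε' : 0 < ε / (4 * Real.pi) := by positivity
  filter_upwards [ha, hcont, hc _ hε'] with N ha hcont hc
  have hi1 := integrable_radialKernel_mul ha hcont
  have hi0 : Integrable (radialKernel (a N)) := by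
    simpa using integrable_radialKernel_mul ha (c := fun _ => (1 : ℝ)) continuousOn_const
  have h1 : (∫ z, radialKernel (a N) z * c z) - 2 * Real.pi * ℓ =
      ∫ z, radialKernel (a N) z * (c z - ℓ) := by
    simp only [mul_sub]
    rw [integral_sub hi1 (hi0.mul_const ℓ), integral_mul_const, integral_radialKernel ha]
  rw [Real.dist_eq, h1, ← Real.norm_eq_abs]
  have h2 : ‖∫ z, radialKernel (a N) z * (c z - ℓ)‖ ≤
      ∫ z, radialKernel (a N) z * (ε / (4 * Real.pi)) := by
    refine norm_integral_le_of_norm_le (hi0.mul_const _) (Eventually.of_forall fun z => ?_)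
    rw [norm_mul, Real.norm_of_nonneg (radialKernel_nonneg ha.le z)]
    by_cases h0 : radialKernel (a N) z = 0
    · simp [h0]
    · exact mul_le_mul_of_nonneg_left (hc z (radialKernel_ne_zero h0).1 (radialKernel_ne_zero h0).2)
        (radialKernel_nonneg ha.le z)
  refine h2.trans_lt ?_
  rw [integral_mul_const, integral_radialKernel ha]
  have := Real.pi_pos
  field_simp
  norm_num

/-! ### Fluxes from limits of angular components -/

theorem eventually_cocompact_iff_norm {p : ℂ → Prop} :
    (∀ᶠ z in cocompact ℂ, p z) ↔ ∃ r : ℝ, ∀ z, r ≤ ‖z‖ → p z := by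
  rw [← Metric.cobounded_eq_cocompact, ← comap_norm_atTop, (atTop_basis.comap _).eventually_iff]
  simp

theorem eventually_norm_ge_of_le (r : ℝ) :
    ∀ᶠ N : ℕ in atTop, ∀ z : ℂ, 1 ≤ ((N : ℝ) + 1)⁻¹ * ‖z‖ ^ 2 → r ≤ ‖z‖ := by
  filter_upwards [eventually_ge_atTop ⌈r ^ 2⌉₊] with N hN z hz
  have h1 : r ^ 2 ≤ N := (Nat.le_ceil _).trans (by exact_mod_cast hN)
  rw [← div_eq_inv_mul, le_div_iff₀ (by positivity)] at hz
  by_contra! h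
  nlinarith [norm_nonneg z]

theorem eventually_norm_lt_of_le {r : ℝ} (hr : 0 < r) :
    ∀ᶠ N : ℕ in atTop, ∀ z : ℂ, ((N : ℝ) + 1) * ‖z‖ ^ 2 ≤ 2 → ‖z‖ < r := by
  filter_upwards [eventually_ge_atTop ⌈2 / r ^ 2⌉₊] with N hN z hz
  have h1 : 2 / r ^ 2 ≤ N := (Nat.le_ceil _).trans (by exact_mod_cast hN)
  rw [div_le_iff₀ (by positivity)] at h1
  by_contra! h
  have : r ^ 2 ≤ ‖z‖ ^ 2 := pow_le_pow_left₀ hr.le h 2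
  nlinarith [sq_pos_of_pos hr, (Nat.cast_nonneg N : (0 : ℝ) ≤ N)]

/-- The flux at `∞` of a 1-form whose angular component converges. -/
theorem hasFlux_infty {β : ℂ → ℂ →L[ℝ] ℝ} {ℓ : ℝ} (hβ : ∀ᶠ z in cocompact ℂ, ContinuousAt β z)
    (hlim : Tendsto (fun z => β z (Complex.I * z)) (cocompact ℂ) (𝓝 ℓ)) :
    HasFlux β OnePoint.infty (2 * Real.pi * ℓ) := by
  have hpos : ∀ N : ℕ, (0 : ℝ) < ((N : ℝ) + 1)⁻¹ := fun N => by positivity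
  refine ⟨fun N z => 1 - radialCutoff ((N : ℝ) + 1)⁻¹ z, ⟨?_, ?_, ?_, ?_, ?_⟩, ?_⟩
  · exact Eventually.of_forall fun N => contDiff_const.sub (contDiff_radialCutoff _)
  · exact fun N z => sub_nonneg.2 (Real.smoothTransition.le_one _)
  · exact fun N z => sub_le_self _ (Real.smoothTransition.nonneg _)
  · refine Eventually.of_forall fun N => ?_
    rw [endNhds_infty, eventually_cocompact_iff_norm]
    refine ⟨2 * (N + 1), fun z hz => ?_⟩
    rw [radialCutoff_eq_zero, sub_zero]
    rw [← div_eq_inv_mul, le_div_iff₀ (by positivity)]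
    nlinarith [(Nat.cast_nonneg N : (0 : ℝ) ≤ N)]
  · intro V hV
    have h1 : ∀ᶠ z : ℂ in cocompact ℂ, (z : OnePoint ℂ) ∈ V := by
      rw [← endNhds_infty]
      exact preimage_mem_comap hV
    obtain ⟨r, hr⟩ := eventually_cocompact_iff_norm.1 h1
    filter_upwards [eventually_norm_ge_of_le r] with N hN z hz
    refine hr z (hN z ?_)
    by_contra! h
    exact hz (by rw [radialCutoff_eq_one h.le, sub_self])
  · have h1 : ∀ (N : ℕ) z, wedge (fderiv ℝ (fun z => 1 - radialCutoff ((N : ℝ) + 1)⁻¹ z) z) (β z) =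
        radialKernel ((N : ℝ) + 1)⁻¹ z * β z (Complex.I * z) := by
      intro N z
      have h2 := wedge_fderiv_radialCutoff ((N : ℝ) + 1)⁻¹ z (β z)
      rw [fderiv_const_sub]
      simp only [wedge, neg_apply] at h2 ⊢
      linarith
    simp only [h1]
    refine tendsto_integral_radialKernel_mul (Eventually.of_forall hpos) ?_ ?_
    · obtain ⟨r, hr⟩ := eventually_cocompact_iff_norm.1 hβ
      filter_upwards [eventually_norm_ge_of_le r] with N hN z hz
      exact ((hr z (hN z hz.1)).clm_apply
        (continuous_const.mul continuous_id).continuousAt).continuousWithinAt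
    · intro ε hε
      obtain ⟨r, hr⟩ := eventually_cocompact_iff_norm.1
        (hlim.eventually (Metric.closedBall_mem_nhds ℓ hε))
      filter_upwards [eventually_norm_ge_of_le r] with N hN z hz _
      exact hr z (hN z hz)

/-- Conformal covariance of 2-forms in dimension two. -/
theorem wedge_comp_mul (a b : ℂ →L[ℝ] ℝ) (μ : ℂ) :
    a μ * b (μ * Complex.I) - a (μ * Complex.I) * b μ = ‖μ‖ ^ 2 * wedge a b := by
  have h1 : μ = μ.re • (1 : ℂ) + μ.im • Complex.I := by apply Complex.ext <;> simp
  have h2 : μ * Complex.I = (-μ.im) • (1 : ℂ) + μ.re • Complex.I := by apply Complex.ext <;> simp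
  have ha : a μ = μ.re * a 1 + μ.im * a Complex.I := by
    conv_lhs => rw [h1, map_add, map_smul, map_smul, smul_eq_mul, smul_eq_mul]
  have hb : b μ = μ.re * b 1 + μ.im * b Complex.I := by
    conv_lhs => rw [h1, map_add, map_smul, map_smul, smul_eq_mul, smul_eq_mul]
  rw [h2, ha, hb, ← Complex.normSq_eq_norm_sq, Complex.normSq_apply, wedge]
  simp only [map_add, map_smul, smul_eq_mul]
  ring

theorem det_toSpanSingleton (μ : ℂ) :
    ((ContinuousLinearMap.toSpanSingleton ℂ μ).restrictScalars ℝ).det = ‖μ‖ ^ 2 := by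
  change LinearMap.det
    (((ContinuousLinearMap.toSpanSingleton ℂ μ : ℂ →L[ℂ] ℂ) : ℂ →ₗ[ℂ] ℂ).restrictScalars ℝ) = _
  rw [LinearMap.det_restrictScalars, LinearMap.det_ring, Algebra.norm_complex_apply,
    Complex.normSq_eq_norm_sq]
  simp

/-- The flux at a point `E 0 ∈ ℂ` of a 1-form whose angular component in the local holomorphic
coordinate `L`, the inverse of `E`, converges. The cutoff functions are radial in this coordinate. -/
theorem hasFlux_of_chart {β : ℂ → ℂ →L[ℝ] ℝ} {ℓ r : ℝ} (hr : 0 < r) {E E' L : ℂ → ℂ}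
    (hE : ∀ ξ ∈ Metric.ball (0 : ℂ) r, HasDerivAt E (E' ξ) ξ)
    (hE' : ContinuousOn E' (Metric.ball (0 : ℂ) r))
    (hLE : ∀ ξ ∈ Metric.ball (0 : ℂ) r, L (E ξ) = ξ)
    (hopen : IsOpen (E '' Metric.ball (0 : ℂ) r))
    (hL : ∀ ξ ∈ Metric.ball (0 : ℂ) r, ContDiffAt ℝ 1 L (E ξ))
    (hβ : ∀ ξ ∈ Metric.ball (0 : ℂ) r, ξ ≠ 0 → ContinuousAt β (E ξ))
    (hlim : Tendsto (fun ξ => β (E ξ) (E' ξ * (Complex.I * ξ))) (𝓝[≠] 0) (𝓝 ℓ)) :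
    HasFlux β (E 0 : ℂ) (-(2 * Real.pi * ℓ)) := by
  classical
  set D := Metric.ball (0 : ℂ) r
  have h0D : (0 : ℂ) ∈ D := Metric.mem_ball_self hr
  have hinj : InjOn E D := fun x hx y hy h => by rw [← hLE x hx, ← hLE y hy, h]
  set ψ : ℕ → ℂ → ℝ := fun N z => if z ∈ E '' D then radialCutoff ((N : ℝ) + 1) (L z) else 0
  have hψE : ∀ N, ∀ ξ ∈ D, ψ N (E ξ) = radialCutoff ((N : ℝ) + 1) ξ := by
    intro N ξ hξ
    simp only [ψ]
    rw [if_pos (mem_image_of_mem E hξ), hLE ξ hξ]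
  have hloc : ∀ N, ∀ ξ ∈ D, ψ N =ᶠ[𝓝 (E ξ)] fun z => radialCutoff ((N : ℝ) + 1) (L z) := by
    intro N ξ hξ
    filter_upwards [hopen.mem_nhds (mem_image_of_mem E hξ)] with z hz
    simp only [ψ]
    rw [if_pos hz]
  have hpos : ∀ N : ℕ, (0 : ℝ) < (N : ℝ) + 1 := fun N => by positivity
  -- The image of a compact disc is closed, and `ψ N` vanishes outside such an image.
  have hout : ∀ᶠ N in atTop, ∀ z ∉ E '' D, ψ N =ᶠ[𝓝 z] 0 := by
    filter_upwards [eventually_norm_lt_of_le (half_pos hr)] with N hN z hz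
    have hsub : Metric.closedBall (0 : ℂ) (r / 2) ⊆ D := Metric.closedBall_subset_ball (by linarith)
    have hcl : IsClosed (E '' Metric.closedBall (0 : ℂ) (r / 2)) :=
      ((isCompact_closedBall _ _).image_of_continuousOn
        fun ξ hξ => (hE ξ (hsub hξ)).continuousAt.continuousWithinAt).isClosed
    have hz' : z ∉ E '' Metric.closedBall (0 : ℂ) (r / 2) := fun h => hz (image_mono hsub h)
    filter_upwards [hcl.isOpen_compl.mem_nhds hz'] with z' hz'
    by_cases h : z' ∈ E '' D
    · obtain ⟨ξ, hξ, rfl⟩ := h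
      rw [hψE N ξ hξ]
      refine radialCutoff_eq_zero ?_
      by_contra! hlt
      exact hz' (mem_image_of_mem E (mem_closedBall_zero_iff.2 (hN ξ hlt.le).le))
    · simp only [ψ]
      rw [if_neg h]
      rfl
  have hdiff : ∀ N, ∀ ξ ∈ D, ContDiffAt ℝ 1 (ψ N) (E ξ) := fun N ξ hξ =>
    ((contDiff_radialCutoff _).contDiffAt.comp _ (hL ξ hξ)).congr_of_eventuallyEq (hloc N ξ hξ)
  refine ⟨ψ, ⟨?_, ?_, ?_, ?_, ?_⟩, ?_⟩
  · filter_upwards [hout] with N hN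
    rw [contDiff_iff_contDiffAt]
    intro z
    by_cases hz : z ∈ E '' D
    · obtain ⟨ξ, hξ, rfl⟩ := hz
      exact hdiff N ξ hξ
    · exact (contDiffAt_const (c := (0 : ℝ))).congr_of_eventuallyEq (hN z hz)
  · intro N z
    simp only [ψ]
    split_ifs
    exacts [Real.smoothTransition.nonneg _, le_rfl]
  · intro N z
    simp only [ψ]
    split_ifs
    exacts [Real.smoothTransition.le_one _, zero_le_one]
  · refine Eventually.of_forall fun N => ?_
    rw [endNhds_coe]
    have h1 : Tendsto (fun z => ((N : ℝ) + 1) * ‖L z‖ ^ 2) (𝓝 (E 0)) (𝓝 0) := by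
      have := ((hL 0 h0D).continuousAt.norm.pow 2).const_mul ((N : ℝ) + 1)
      simpa [ContinuousAt, hLE 0 h0D] using this
    filter_upwards [hloc N 0 h0D, h1.eventually (gt_mem_nhds zero_lt_one)] with z hz h
    rw [hz, radialCutoff_eq_one h.le]
  · intro V hV
    have hV' : ∀ᶠ z in 𝓝 (E 0), ((z : ℂ) : OnePoint ℂ) ∈ V := by
      rw [← endNhds_coe]
      exact preimage_mem_comap hV
    obtain ⟨δ, hδ, hδV⟩ := Metric.eventually_nhds_iff_ball.1
      ((hE 0 h0D).continuousAt.eventually hV')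
    filter_upwards [eventually_norm_lt_of_le hδ] with N hN z hz
    by_cases h : z ∈ E '' D
    · obtain ⟨ξ, hξ, rfl⟩ := h
      rw [hψE N ξ hξ] at hz
      refine hδV ξ (mem_ball_zero_iff.2 (hN ξ ?_))
      by_contra! hlt
      exact hz (radialCutoff_eq_zero hlt.le)
    · exact absurd (if_neg h) hz
  · set c : ℂ → ℝ := fun ξ => β (E ξ) (E' ξ * (Complex.I * ξ))
    have hsmall := eventually_norm_lt_of_le hr
    have hsupp : ∀ᶠ N : ℕ in atTop, ∀ ξ ∉ D, radialKernel ((N : ℝ) + 1) ξ * c ξ = 0 := by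
      filter_upwards [hsmall] with N hN ξ hξ
      by_contra h
      exact hξ (mem_ball_zero_iff.2 (hN ξ (radialKernel_ne_zero (left_ne_zero_of_mul h)).2))
    have hne : ∀ (N : ℕ) (ξ : ℂ), 1 ≤ ((N : ℝ) + 1) * ‖ξ‖ ^ 2 → ξ ≠ 0 := by
      rintro N ξ h rfl
      norm_num at h
    have hmain : ∀ᶠ N : ℕ in atTop, -∫ ξ, radialKernel ((N : ℝ) + 1) ξ * c ξ =
        ∫ z, wedge (fderiv ℝ (ψ N) z) (β z) := by
      filter_upwards [hsupp, hout] with N hs ho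
      have ho' : ∀ z ∉ E '' D, wedge (fderiv ℝ (ψ N) z) (β z) = 0 := fun z hz => by
        rw [(ho z hz).fderiv_eq]
        simp [wedge]
      rw [← setIntegral_eq_integral_of_forall_compl_eq_zero hs,
        ← setIntegral_eq_integral_of_forall_compl_eq_zero ho',
        integral_image_eq_integral_abs_det_fderiv_smul volume Metric.isOpen_ball.measurableSet
          (fun ξ hξ => ((hE ξ hξ).hasFDerivAt.restrictScalars ℝ).hasFDerivWithinAt) hinj,
        ← integral_neg]
      refine setIntegral_congr_fun Metric.isOpen_ball.measurableSet fun ξ hξ => ?_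
      have hdE : HasFDerivAt E ((ContinuousLinearMap.toSpanSingleton ℂ (E' ξ)).restrictScalars ℝ) ξ :=
        (hE ξ hξ).hasFDerivAt.restrictScalars ℝ
      have hchain : ∀ v, fderiv ℝ (radialCutoff ((N : ℝ) + 1)) ξ v =
          fderiv ℝ (ψ N) (E ξ) (E' ξ * v) := by
        intro v
        have h1 : radialCutoff ((N : ℝ) + 1) =ᶠ[𝓝 ξ] ψ N ∘ E := by
          filter_upwards [Metric.isOpen_ball.mem_nhds hξ] with ξ' hξ' using (hψE N ξ' hξ').symm
        rw [h1.fderiv_eq, ((((hdiff N ξ hξ).differentiableAt one_ne_zero).hasFDerivAt).comp ξ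
          hdE).fderiv]
        simp [mul_comm]
      have h2 := wedge_fderiv_radialCutoff ((N : ℝ) + 1) ξ
        ((β (E ξ)).comp (ContinuousLinearMap.mul ℝ ℂ (E' ξ)))
      have h3 := wedge_comp_mul (fderiv ℝ (ψ N) (E ξ)) (β (E ξ)) (E' ξ)
      rw [wedge, hchain, hchain] at h2
      simp only [ContinuousLinearMap.comp_apply, ContinuousLinearMap.mul_apply', mul_one] at h2
      simp only [c]
      rw [det_toSpanSingleton, abs_of_nonneg (sq_nonneg _), smul_eq_mul, ← h3, ← h2]
    refine (tendsto_integral_radialKernel_mul (ℓ := ℓ) (c := c) (Eventually.of_forall hpos)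
      ?_ ?_).neg.congr' hmain
    · filter_upwards [hsmall] with N hN ξ hξ
      have hξD : ξ ∈ D := mem_ball_zero_iff.2 (hN ξ hξ.2)
      exact (((hβ ξ hξD (hne N ξ hξ.1)).comp (hE ξ hξD).continuousAt).clm_apply
        ((hE'.continuousAt (Metric.isOpen_ball.mem_nhds hξD)).mul
          (continuous_const.mul continuous_id).continuousAt)).continuousWithinAt
    · intro ε hε
      have := hlim.eventually (Metric.closedBall_mem_nhds ℓ hε)
      rw [eventually_nhdsWithin_iff, Metric.eventually_nhds_iff_ball] at this
      obtain ⟨δ, hδ, h⟩ := this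
      filter_upwards [eventually_norm_lt_of_le hδ] with N hN ξ h1 h2
      exact h ξ (mem_ball_zero_iff.2 (hN ξ h2)) (hne N ξ h1)

/-! ### Pullbacks of 1-forms -/

section Pullback

variable {n : ℕ} {M : Type} [TopologicalSpace M] [ChartedSpace (EuclideanSpace ℝ (Fin n)) M]
  {F : Type*} [NormedAddCommGroup F] [NormedSpace ℝ F]

/-- The pullback of a 1-form to a vector space. -/
def pullback (β : ∀ x : M, TangentSpace (𝓡 n) x →L[ℝ] ℝ) (u : F → M) (z : F) : F →L[ℝ] ℝ :=
  (β (u z)).comp (mfderiv 𝓘(ℝ, F) (𝓡 n) u z)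

theorem pullback_congr (β : ∀ x : M, TangentSpace (𝓡 n) x →L[ℝ] ℝ) {u u' : F → M} {z : F}
    (h : u =ᶠ[𝓝 z] u') : pullback β u z = pullback β u' z := by
  have h1 : mfderiv 𝓘(ℝ, F) (𝓡 n) u z = mfderiv 𝓘(ℝ, F) (𝓡 n) u' z := h.mfderiv_eq
  let B : M → EuclideanSpace ℝ (Fin n) →L[ℝ] ℝ := fun x => β x
  have h2 : B (u z) = B (u' z) := congrArg B h.eq_of_nhds
  let D : F →L[ℝ] EuclideanSpace ℝ (Fin n) := mfderiv 𝓘(ℝ, F) (𝓡 n) u z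
  let D' : F →L[ℝ] EuclideanSpace ℝ (Fin n) := mfderiv 𝓘(ℝ, F) (𝓡 n) u' z
  have h3 : D = D' := h1
  change (B (u z)).comp D = (B (u' z)).comp D'
  rw [h2, h3]

variable [IsManifold (𝓡 n) ∞ M]

theorem mdifferentiableAt_extChartAt_symm {x : M} {e : EuclideanSpace ℝ (Fin n)}
    (he : e ∈ (extChartAt (𝓡 n) x).target) :
    MDifferentiableAt 𝓘(ℝ, EuclideanSpace ℝ (Fin n)) (𝓡 n) (extChartAt (𝓡 n) x).symm e :=
  ((contMDiffOn_extChartAt_symm (n := ∞) x).contMDiffAt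
    ((isOpen_extChartAt_target x).mem_nhds he)).mdifferentiableAt (by simp)

/-- The pullback of a 1-form in terms of a chart of the target. -/
theorem pullback_eq_chartRep (β : ∀ x : M, TangentSpace (𝓡 n) x →L[ℝ] ℝ) {u : F → M} {z : F}
    (x : M) (hu : MDifferentiableAt 𝓘(ℝ, F) (𝓡 n) u z) (hx : u z ∈ (extChartAt (𝓡 n) x).source) :
    pullback β u z = (chartRep β x (extChartAt (𝓡 n) x (u z))).comp
      (fderiv ℝ (fun z => extChartAt (𝓡 n) x (u z)) z) := by
  have hV : MDifferentiableAt 𝓘(ℝ, F) 𝓘(ℝ, EuclideanSpace ℝ (Fin n))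
      (fun z => extChartAt (𝓡 n) x (u z)) z :=
    (mdifferentiableAt_extChartAt (I := 𝓡 n) (by simpa using hx)).comp z hu
  have hcongr : u =ᶠ[𝓝 z] (extChartAt (𝓡 n) x).symm ∘ fun z => extChartAt (𝓡 n) x (u z) := by
    filter_upwards [hu.continuousAt.preimage_mem_nhds
      ((isOpen_extChartAt_source (I := 𝓡 n) x).mem_nhds hx)] with z' hz'
    exact ((extChartAt (𝓡 n) x).left_inv hz').symm
  rw [pullback_congr β hcongr, pullback, mfderiv_comp z
    (mdifferentiableAt_extChartAt_symm ((extChartAt (𝓡 n) x).map_source hx)) hV, mfderiv_eq_fderiv]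
  rfl

theorem contDiffAt_pullback {β : ∀ x : M, TangentSpace (𝓡 n) x →L[ℝ] ℝ} (hβ : SmoothOneForm β)
    {u : F → M} {U : Set F} (hU : IsOpen U) (hu : ContMDiffOn 𝓘(ℝ, F) (𝓡 n) ∞ u U) {z : F}
    (hz : z ∈ U) : ContDiffAt ℝ ∞ (pullback β u) z := by
  set x := u z
  have hV : ContDiffAt ℝ ∞ (fun z => extChartAt (𝓡 n) x (u z)) z := by
    rw [← contMDiffAt_iff_contDiffAt]
    exact (contMDiffAt_extChartAt' (by simp [x])).comp z (hu.contMDiffAt (hU.mem_nhds hz))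
  have h1 : ContDiffAt ℝ ∞ (fun z => (chartRep β x (extChartAt (𝓡 n) x (u z))).comp
      (fderiv ℝ (fun z => extChartAt (𝓡 n) x (u z)) z)) z := by
    refine ContDiffAt.clm_comp ?_ (hV.fderiv_right (by simp))
    exact ((hβ x).contDiffAt ((isOpen_extChartAt_target x).mem_nhds
      (mem_extChartAt_target x))).comp z hV
  refine h1.congr_of_eventuallyEq ?_
  have hc : ContinuousAt u z := (hu.continuousOn.continuousAt (hU.mem_nhds hz))
  filter_upwards [hU.mem_nhds hz, hc.preimage_mem_nhds
      ((isOpen_extChartAt_source (I := 𝓡 n) x).mem_nhds (mem_extChartAt_source x))] with z' hz' hs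
  exact pullback_eq_chartRep β x ((hu.contMDiffAt (hU.mem_nhds hz')).mdifferentiableAt (by simp)) hs

/-- The exterior derivative commutes with pullbacks. -/
theorem fderiv_pullback_sub {β : ∀ x : M, TangentSpace (𝓡 n) x →L[ℝ] ℝ} (hβ : SmoothOneForm β)
    {u : F → M} {U : Set F} (hU : IsOpen U) (hu : ContMDiffOn 𝓘(ℝ, F) (𝓡 n) ∞ u U) {z : F}
    (hz : z ∈ U) (a b : F) :
    fderiv ℝ (pullback β u) z a b - fderiv ℝ (pullback β u) z b a =
      extD β (u z) (mfderiv 𝓘(ℝ, F) (𝓡 n) u z a) (mfderiv 𝓘(ℝ, F) (𝓡 n) u z b) := by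
  set x := u z
  set V : F → EuclideanSpace ℝ (Fin n) := fun z => extChartAt (𝓡 n) x (u z)
  have hum := hu.contMDiffAt (hU.mem_nhds hz)
  have hV : ContDiffAt ℝ ∞ V z := by
    rw [← contMDiffAt_iff_contDiffAt]
    exact (contMDiffAt_extChartAt' (by simp [x])).comp z hum
  have hR : ContDiffAt ℝ ∞ (chartRep β x) (V z) :=
    (hβ x).contDiffAt ((isOpen_extChartAt_target x).mem_nhds (mem_extChartAt_target x))
  have hdu : mfderiv 𝓘(ℝ, F) (𝓡 n) u z = fderiv ℝ V z := by
    rw [(hum.mdifferentiableAt (by simp)).mfderiv]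
    simp only [writtenInExtChartAt, Function.comp_def, mfld_simps,
      fderivWithin_univ]
    rfl
  have hcongr : pullback β u =ᶠ[𝓝 z] fun z => (chartRep β x (V z)).comp (fderiv ℝ V z) := by
    have hc : ContinuousAt u z := (hu.continuousOn.continuousAt (hU.mem_nhds hz))
    filter_upwards [hU.mem_nhds hz, hc.preimage_mem_nhds
      ((isOpen_extChartAt_source (I := 𝓡 n) x).mem_nhds (mem_extChartAt_source x))] with z' hz' hs
    exact pullback_eq_chartRep β x ((hu.contMDiffAt (hU.mem_nhds hz')).mdifferentiableAt (by simp)) hs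
  have hRd : DifferentiableAt ℝ (chartRep β x) (V z) := hR.differentiableAt (by simp)
  have hVd : DifferentiableAt ℝ V z := hV.differentiableAt (by simp)
  have hV2 : DifferentiableAt ℝ (fderiv ℝ V) z :=
    (hV.fderiv_right (m := 1) (by norm_cast)).differentiableAt one_ne_zero
  have hsymm : fderiv ℝ (fderiv ℝ V) z a b = fderiv ℝ (fderiv ℝ V) z b a :=
    (hV.isSymmSndFDerivAt (by
      rw [minSmoothness_of_isRCLikeNormedField]; exact WithTop.coe_le_coe.2 le_top)).eq a b
  have hd : HasFDerivAt (fun z => (chartRep β x (V z)).comp (fderiv ℝ V z)) _ z :=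
    (hRd.hasFDerivAt.comp z hVd.hasFDerivAt).clm_comp hV2.hasFDerivAt
  have hval : ∀ a b : F, fderiv ℝ (pullback β u) z a b =
      chartRep β x (V z) (fderiv ℝ (fderiv ℝ V) z a b) +
        fderiv ℝ (chartRep β x) (V z) (fderiv ℝ V z a) (fderiv ℝ V z b) := by
    intro a b
    rw [hcongr.fderiv_eq, hd.fderiv]
    simp
  have hE : ∀ v w : EuclideanSpace ℝ (Fin n),
      fderiv ℝ (fun e => chartRep β x e v) (V z) w = fderiv ℝ (chartRep β x) (V z) w v := by
    intro v w
    rw [fderiv_clm_apply hRd (differentiableAt_const v)]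
    simp
  have hext : extD β x (mfderiv 𝓘(ℝ, F) (𝓡 n) u z a) (mfderiv 𝓘(ℝ, F) (𝓡 n) u z b) =
      fderiv ℝ (chartRep β x) (V z) (fderiv ℝ V z a) (fderiv ℝ V z b) -
        fderiv ℝ (chartRep β x) (V z) (fderiv ℝ V z b) (fderiv ℝ V z a) := by
    rw [hdu, ← hE, ← hE]
    rfl
  rw [hext, hval, hval, hsymm]
  ring

/-- A smooth 1-form is continuous as a function on the tangent bundle. -/
theorem SmoothOneForm.continuous_apply {β : ∀ x : M, TangentSpace (𝓡 n) x →L[ℝ] ℝ}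
    (hβ : SmoothOneForm β) : Continuous fun p : TangentBundle (𝓡 n) M => β p.1 p.2 := by
  rw [continuous_iff_continuousAt]
  intro p₀
  set x := p₀.1
  set T := trivializationAt (EuclideanSpace ℝ (Fin n)) (TangentSpace (𝓡 n) : M → Type) x
  have hx : x ∈ T.baseSet := FiberBundle.mem_baseSet_trivializationAt' x
  have hT : ContinuousAt (fun p : TangentBundle (𝓡 n) M => (T p).2) p₀ :=
    (T.continuousAt (T.mem_source.2 hx)).snd
  have hproj : ContinuousAt (fun p : TangentBundle (𝓡 n) M => p.1) p₀ :=
    (FiberBundle.continuous_proj _ _).continuousAt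
  have h1 : ContinuousAt (fun p : TangentBundle (𝓡 n) M =>
      chartRep β x (extChartAt (𝓡 n) x p.1) (T p).2) p₀ := by
    refine ContinuousAt.clm_apply ?_ hT
    have h2 : ContinuousAt (chartRep β x) (extChartAt (𝓡 n) x p₀.1) :=
      ((hβ x).contDiffAt ((isOpen_extChartAt_target x).mem_nhds
        (mem_extChartAt_target x))).continuousAt
    exact h2.comp (f := fun p : TangentBundle (𝓡 n) M => extChartAt (𝓡 n) x p.1)
      ((continuousAt_extChartAt (I := 𝓡 n) x).comp
        (f := fun p : TangentBundle (𝓡 n) M => p.1) hproj)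
  refine h1.congr ?_
  filter_upwards [hproj.preimage_mem_nhds ((chartAt (EuclideanSpace ℝ (Fin n)) x).open_source.mem_nhds
    (mem_chart_source _ x))] with p hp
  have hp' : p.1 ∈ T.baseSet := hp
  have h3 : T.symmL ℝ p.1 (T p).2 = p.2 := by
    rw [T.symmL_apply hp']
    exact T.symm_proj_apply p hp'
  have h4 := TangentBundle.symmL_trivializationAt (I := 𝓡 n) hp
  rw [ModelWithCorners.range_eq_univ, mfderivWithin_univ] at h4
  conv_rhs => rw [← h3, h4]
  let B : M → EuclideanSpace ℝ (Fin n) →L[ℝ] ℝ := fun y => β y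
  have h5 : B ((extChartAt (𝓡 n) x).symm (extChartAt (𝓡 n) x p.1)) = B p.1 :=
    congrArg B ((extChartAt (𝓡 n) x).left_inv (by simpa using hp))
  exact DFunLike.congr_fun h5 _

end Pullback

/-! ### Positivity of the area form along Floer cylinders -/

section Area

variable {m : ℕ}
  {Y : Type} [TopologicalSpace Y] [ChartedSpace (EuclideanSpace ℝ (Fin (2 * m + 1))) Y]
  {S : Type} [TopologicalSpace S] [ChartedSpace (EuclideanSpace ℝ (Fin (2 * m))) S]

theorem extD_antisymm (β : ∀ y : Y, TangentSpace (𝓡 (2 * m + 1)) y →L[ℝ] ℝ) (y : Y)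
    (u v : TangentSpace (𝓡 (2 * m + 1)) y) : extD β y u v = -extD β y v u := by
  simp only [extD]
  ring

namespace ReebCircleBundle

variable (P : ReebCircleBundle m Y S)

theorem ωS_antisymm (x : S) (a b : TangentSpace (𝓡 (2 * m)) x) : P.ωS x a b = -P.ωS x b a := by
  obtain ⟨y, rfl⟩ := P.proj_surjective x
  obtain ⟨a, rfl⟩ := P.proj_submersion y a
  obtain ⟨b, rfl⟩ := P.proj_submersion y b
  rw [P.ωS_proj, P.ωS_proj, extD_antisymm]

theorem mdifferentiableAt_proj (y : Y) :
    MDifferentiableAt (𝓡 (2 * m + 1)) (𝓡 (2 * m)) P.proj y :=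
  P.proj_smooth.contMDiffAt.mdifferentiableAt (by simp)

theorem mfderiv_proj_R (y : Y) : mfderiv (𝓡 (2 * m + 1)) (𝓡 (2 * m)) P.proj y (P.R y) = 0 := by
  suffices h : ∀ y', P.flow 0 y = y' →
      mfderiv (𝓡 (2 * m + 1)) (𝓡 (2 * m)) P.proj y' (P.R y') = 0 from h y (P.flow_zero y)
  rintro _ rfl
  have h1 := ((P.mdifferentiableAt_proj (P.flow 0 y)).hasMFDerivAt).comp (0 : ℝ)
    (P.flow_integral y 0)
  have h2 : P.proj ∘ (fun t => P.flow t y) = fun _ => P.proj y := by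
    funext t
    exact ((P.proj_eq_iff y (P.flow t y)).2 ⟨t, rfl⟩).symm
  rw [h2] at h1
  have h3 := hasMFDerivAt_unique h1 (hasMFDerivAt_const (P.proj y) (0 : ℝ))
  have h4 := DFunLike.congr_fun h3 (1 : ℝ)
  have h5 : mfderiv (𝓡 (2 * m + 1)) (𝓡 (2 * m)) P.proj (P.flow 0 y)
      ((1 : ℝ) • P.R (P.flow 0 y)) = 0 := h4
  rwa [one_smul] at h5

/-- The contact components of a solution of Floer's equation are related by `J`, which is positive
on the contact hyperplanes. -/
theorem ωS_nonneg_of_floer {J : ∀ y : Y, (ℝ × TangentSpace (𝓡 (2 * m + 1)) y) →L[ℝ]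
    (ℝ × TangentSpace (𝓡 (2 * m + 1)) y)} (hJ : IsAdmissibleJ P J) (y : Y) (bs bt c : ℝ)
    (vs vt : TangentSpace (𝓡 (2 * m + 1)) y)
    (h : ((bs, vs) : ℝ × TangentSpace (𝓡 (2 * m + 1)) y) +
      J y (((bt, vt) : ℝ × TangentSpace (𝓡 (2 * m + 1)) y) - (0, c • P.R y)) = 0) :
    let dp := mfderiv (𝓡 (2 * m + 1)) (𝓡 (2 * m)) P.proj y
    0 ≤ P.ωS (P.proj y) (dp vs) (dp vt) ∧
      (P.ωS (P.proj y) (dp vs) (dp vt) = 0 → dp vs = 0 ∧ dp vt = 0) := by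
  intro dp
  -- The contact components of `vs` and `vt`; they have the same images under `dp`.
  set ξs := vs - P.α y vs • P.R y with hξs
  set ξt := vt - P.α y vt • P.R y with hξt
  have hdR : dp (P.R y) = 0 := P.mfderiv_proj_R y
  have hs : dp vs = dp ξs := by rw [hξs, map_sub, map_smul, hdR, smul_zero, sub_zero]
  have ht : dp vt = dp ξt := by rw [hξt, map_sub, map_smul, hdR, smul_zero, sub_zero]
  have hαt : P.α y ξt = 0 := by rw [hξt, map_sub, map_smul, P.α_R, smul_eq_mul, mul_one, sub_self]
  have hαs : P.α y ξs = 0 := by rw [hξs, map_sub, map_smul, P.α_R, smul_eq_mul, mul_one, sub_self]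
  have hJR : J y (0, P.R y) = (-1, 0) := by
    rw [← hJ.J_dr, hJ.sq]
    simp
  obtain ⟨hJ1, hJ2⟩ := hJ.J_ξ y ξt hαt
  have hdec : ((bt, vt) : ℝ × TangentSpace (𝓡 (2 * m + 1)) y) - (0, c • P.R y) =
      bt • ((1, 0) : ℝ × TangentSpace (𝓡 (2 * m + 1)) y) + (P.α y vt - c) • (0, P.R y) + (0, ξt) := by
    ext1
    · simp
    · simp only [hξt, Prod.snd_sub, Prod.snd_add, Prod.smul_snd, smul_zero, zero_add, sub_smul]
      abel
  rw [hdec, map_add, map_add, map_smul, map_smul, hJ.J_dr, hJR] at h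
  have h2 : vs + (bt • P.R y + (J y (0, ξt)).2) = 0 := by
    simpa using congrArg Prod.snd h
  have h3 : P.α y vs = -bt := by
    have := congrArg (P.α y) h2
    rw [map_add, map_add, map_smul, P.α_R, hJ2, map_zero, smul_eq_mul] at this
    linarith
  have h4 : ((0, ξs) : ℝ × TangentSpace (𝓡 (2 * m + 1)) y) = -J y (0, ξt) := by
    ext1
    · simp [hJ1]
    · simp only [hξs, h3, Prod.snd_neg, neg_smul, sub_neg_eq_add]
      rw [eq_neg_iff_add_eq_zero, add_assoc, h2]
  -- The contact part of the equation: `ξt = J ξs`, so that the area is `dα(ξs, J ξs)`.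
  have h5 : J y (0, ξs) = (0, ξt) := by rw [h4, map_neg, hJ.sq, neg_neg]
  rw [hs, ht]
  by_cases h0 : ξs = 0
  · have h6 : ((0, ξt) : ℝ × TangentSpace (𝓡 (2 * m + 1)) y) = 0 := by
      rw [← h5, h0]
      exact map_zero _
    have h7 : ξt = 0 := congrArg Prod.snd h6
    rw [h0, h7]
    simp
  · have hne : ((0, ξs) : ℝ × TangentSpace (𝓡 (2 * m + 1)) y) ≠ 0 := fun h => h0 (congrArg Prod.snd h)
    have hp := hJ.pos 0 y _ hne
    rw [h5] at hp
    simp only [sympForm, Real.exp_zero, one_mul, zero_mul, sub_zero, zero_add] at hp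
    rw [← P.ωS_proj] at hp
    exact ⟨hp.le, fun h => absurd h hp.ne'⟩

/-- The density `f^* ωS (1, i)` of the area form pulled back by a map from the plane. -/
def areaAt (f : ℂ → S) (z : ℂ) : ℝ :=
  P.ωS (f z) (mfderiv 𝓘(ℝ, ℂ) (𝓡 (2 * m)) f z (1 : ℂ)) (mfderiv 𝓘(ℝ, ℂ) (𝓡 (2 * m)) f z Complex.I)

theorem areaAt_congr {f f' : ℂ → S} {z : ℂ} (h : f =ᶠ[𝓝 z] f') : P.areaAt f z = P.areaAt f' z := by
  let W : S → EuclideanSpace ℝ (Fin (2 * m)) →L[ℝ] EuclideanSpace ℝ (Fin (2 * m)) →L[ℝ] ℝ :=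
    fun x => P.ωS x
  have hW : W (f z) = W (f' z) := congrArg W h.eq_of_nhds
  let D : ℂ →L[ℝ] EuclideanSpace ℝ (Fin (2 * m)) := mfderiv 𝓘(ℝ, ℂ) (𝓡 (2 * m)) f z
  let D' : ℂ →L[ℝ] EuclideanSpace ℝ (Fin (2 * m)) := mfderiv 𝓘(ℝ, ℂ) (𝓡 (2 * m)) f' z
  have hD : D = D' := h.mfderiv_eq
  change W (f z) (D 1) (D Complex.I) = W (f' z) (D' 1) (D' Complex.I)
  rw [hW, hD]

theorem areaAt_proj_comp {u : ℂ → Y} {z : ℂ}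
    (hu : MDifferentiableAt 𝓘(ℝ, ℂ) (𝓡 (2 * m + 1)) u z) :
    P.areaAt (P.proj ∘ u) z =
      P.ωS (P.proj (u z))
        (mfderiv (𝓡 (2 * m + 1)) (𝓡 (2 * m)) P.proj (u z)
          (mfderiv 𝓘(ℝ, ℂ) (𝓡 (2 * m + 1)) u z (1 : ℂ)))
        (mfderiv (𝓡 (2 * m + 1)) (𝓡 (2 * m)) P.proj (u z)
          (mfderiv 𝓘(ℝ, ℂ) (𝓡 (2 * m + 1)) u z Complex.I)) := by
  rw [areaAt, mfderiv_comp z (P.mdifferentiableAt_proj _) hu]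
  rfl

/-- A bilinear alternating form is conformally covariant. -/
theorem alternating_comp_mul {E : Type*} [AddCommGroup E] [Module ℝ E] (A : E → E → ℝ)
    (hadd : ∀ a a' b, A (a + a') b = A a b + A a' b) (hsmul : ∀ (c : ℝ) a b, A (c • a) b = c * A a b)
    (hanti : ∀ a b, A a b = -A b a) (D : ℂ →ₗ[ℝ] E) (μ : ℂ) :
    A (D μ) (D (μ * Complex.I)) = ‖μ‖ ^ 2 * A (D 1) (D Complex.I) := by
  have h1 : D μ = μ.re • D 1 + μ.im • D Complex.I := by
    rw [← map_smul, ← map_smul, ← map_add]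
    congr 1
    apply Complex.ext <;> simp
  have h2 : D (μ * Complex.I) = (-μ.im) • D 1 + μ.re • D Complex.I := by
    rw [← map_smul, ← map_smul, ← map_add]
    congr 1
    apply Complex.ext <;> simp
  have hadd' : ∀ a b b', A a (b + b') = A a b + A a b' := fun a b b' => by
    rw [hanti, hadd, hanti b, hanti b']; ring
  have hsmul' : ∀ (c : ℝ) a b, A a (c • b) = c * A a b := fun c a b => by
    rw [hanti, hsmul, hanti b]; ring
  have hself : ∀ a, A a a = 0 := fun a => by linarith [hanti a a]
  rw [h1, h2, ← Complex.normSq_eq_norm_sq, Complex.normSq_apply]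
  simp only [hadd, hadd', hsmul, hsmul', hself, hanti (D Complex.I) (D 1)]
  ring

theorem areaAt_comp {f : ℂ → S} {g : ℂ → ℂ} {μ ζ : ℂ} (hg : HasDerivAt g μ ζ)
    (hf : MDifferentiableAt 𝓘(ℝ, ℂ) (𝓡 (2 * m)) f (g ζ)) :
    P.areaAt (f ∘ g) ζ = ‖μ‖ ^ 2 * P.areaAt f (g ζ) := by
  have hg' : HasMFDerivAt 𝓘(ℝ, ℂ) 𝓘(ℝ, ℂ) g ζ
      ((ContinuousLinearMap.toSpanSingleton ℂ μ).restrictScalars ℝ) :=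
    (hg.hasFDerivAt.restrictScalars ℝ).hasMFDerivAt
  have h1 := (hf.hasMFDerivAt.comp ζ hg').mfderiv
  let D : ℂ →ₗ[ℝ] TangentSpace (𝓡 (2 * m)) (f (g ζ)) :=
    (mfderiv 𝓘(ℝ, ℂ) (𝓡 (2 * m)) f (g ζ)).toLinearMap
  have h2 := alternating_comp_mul (fun a b => P.ωS (f (g ζ)) a b) (fun a a' b => by simp)
    (fun c a b => by simp) (P.ωS_antisymm _) D μ
  rw [areaAt, h1]
  refine Eq.trans ?_ h2
  change P.ωS (f (g ζ)) (D ((1 : ℂ) • μ)) (D (Complex.I • μ)) = _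
  rw [smul_eq_mul, smul_eq_mul, one_mul, mul_comm Complex.I μ]

end ReebCircleBundle

end Area

/-! ### The cylinder as a punctured plane -/

/-- The covering `ζ ↦ e^{2πζ}` of the punctured plane by the plane. -/
def expMap (ζ : ℂ) : ℂ := Complex.exp (2 * Real.pi * ζ)

/-- The covering `s + it ↦ (s, t)` of the cylinder by the plane. -/
def coverC (ζ : ℂ) : ℝ × UnitAddCircle := cover (ζ.re, ζ.im)

/-- The principal branch of the inverse of `expMap`, in real coordinates. -/
def polarLog (z : ℂ) : ℝ × ℝ := (Real.log ‖z‖ / (2 * Real.pi), z.arg / (2 * Real.pi))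

/-- A map on the cylinder, as a map on the punctured plane. -/
def onPlane {X : Type*} (f : ℝ × UnitAddCircle → X) (z : ℂ) : X := f (cover (polarLog z))

theorem two_pi_ne_zero' : (2 * Real.pi : ℂ) ≠ 0 := by
  simp [Real.pi_ne_zero]

theorem expMap_ne_zero (ζ : ℂ) : expMap ζ ≠ 0 := Complex.exp_ne_zero _

theorem expMap_polarLog {z : ℂ} (hz : z ≠ 0) :
    expMap ((polarLog z).1 + (polarLog z).2 * Complex.I) = z := by
  have h : (2 * Real.pi : ℂ) * ((polarLog z).1 + (polarLog z).2 * Complex.I) = Complex.log z := by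
    rw [Complex.log, polarLog]
    push_cast
    field_simp
  rw [expMap, h, Complex.exp_log hz]

/-- `expMap` and `coverC` have the same fibres, so the cylinder is the punctured plane. -/
theorem expMap_eq_iff {ζ ζ' : ℂ} : expMap ζ = expMap ζ' ↔ coverC ζ = coverC ζ' := by
  have h1 : expMap ζ = expMap ζ' ↔ ∃ k : ℤ, ζ = ζ' + k * Complex.I := by
    rw [expMap, expMap, Complex.exp_eq_exp_iff_exists_int]
    refine exists_congr fun k => ?_
    rw [show 2 * (Real.pi : ℂ) * ζ' + k * (2 * Real.pi * Complex.I) =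
      2 * Real.pi * (ζ' + k * Complex.I) by ring]
    exact mul_right_inj' two_pi_ne_zero'
  have h2 : coverC ζ = coverC ζ' ↔ ζ.re = ζ'.re ∧ ∃ k : ℤ, ζ.im = ζ'.im + k := by
    simp only [coverC, cover, Prod.mk.injEq]
    refine and_congr_right fun _ => ?_
    rw [eq_comm, QuotientAddGroup.eq, AddSubgroup.mem_zmultiples_iff]
    refine exists_congr fun k => ?_
    simp only [zsmul_eq_mul, mul_one]
    constructor <;> intro h <;> linarith
  rw [h1, h2, ← exists_and_left]
  refine exists_congr fun k => ?_
  rw [Complex.ext_iff]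
  simp

theorem onPlane_expMap {X : Type*} (f : ℝ × UnitAddCircle → X) (ζ : ℂ) :
    onPlane f (expMap ζ) = f (coverC ζ) := by
  have h := expMap_eq_iff.1 (expMap_polarLog (expMap_ne_zero ζ))
  rw [onPlane, ← h]
  simp [coverC]

theorem hasDerivAt_expMap (ζ : ℂ) : HasDerivAt expMap (2 * Real.pi * expMap ζ) ζ := by
  have := ((hasDerivAt_id ζ).const_mul (2 * Real.pi : ℂ)).cexp
  simp only [mul_one, id] at this
  exact this.congr_deriv (mul_comm _ _)

theorem expMap_add (ζ ζ' : ℂ) : expMap (ζ + ζ') = expMap ζ * expMap ζ' := by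
  rw [expMap, mul_add, Complex.exp_add]
  rfl

/-- The branch of the inverse of `expMap` with the value `ζ₀` at `expMap ζ₀`. -/
def localLog (ζ₀ z : ℂ) : ℂ := ζ₀ + Complex.log (z / expMap ζ₀) / (2 * Real.pi)

theorem expMap_localLog (ζ₀ : ℂ) {z : ℂ} (hz : z ≠ 0) : expMap (localLog ζ₀ z) = z := by
  rw [localLog, expMap_add, expMap, expMap, mul_div_cancel₀ _ two_pi_ne_zero',
    Complex.exp_log (div_ne_zero hz (Complex.exp_ne_zero _)), mul_div_cancel₀]
  exact Complex.exp_ne_zero _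

theorem localLog_self (ζ₀ : ℂ) : localLog ζ₀ (expMap ζ₀) = ζ₀ := by
  rw [localLog, div_self (expMap_ne_zero _), Complex.log_one, zero_div, add_zero]

theorem contDiffAt_localLog {n : WithTop ℕ∞} {ζ₀ z : ℂ} (hz : z / expMap ζ₀ ∈ Complex.slitPlane) :
    ContDiffAt ℝ n (localLog ζ₀) z := by
  have h1 : ContDiffAt ℂ n (localLog ζ₀) z :=
    contDiffAt_const.add (((Complex.contDiffAt_log hz).comp z (contDiffAt_id.div_const _)).div_const _)
  exact h1.restrict_scalars ℝ

theorem localLog_expMap_add {ζ₀ ξ : ℂ} (hξ : ‖ξ‖ < 1 / 4) : localLog ζ₀ (expMap (ζ₀ + ξ)) = ζ₀ + ξ := by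
  have him : |ξ.im| < 1 / 4 := (Complex.abs_im_le_norm ξ).trans_lt hξ
  have hpi := Real.pi_pos
  rw [abs_lt] at him
  rw [localLog, expMap_add, mul_div_cancel_left₀ _ (expMap_ne_zero _), expMap, Complex.log_exp,
    mul_div_cancel_left₀ _ two_pi_ne_zero']
  · simp only [Complex.mul_im, Complex.mul_re, Complex.re_ofNat, Complex.im_ofNat, Complex.ofReal_re,
      Complex.ofReal_im]
    nlinarith
  · simp only [Complex.mul_im, Complex.mul_re, Complex.re_ofNat, Complex.im_ofNat, Complex.ofReal_re,
      Complex.ofReal_im]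
    nlinarith

theorem expMap_mem_slitPlane {ξ : ℂ} (hξ : ‖ξ‖ < 1 / 4) : expMap ξ ∈ Complex.slitPlane := by
  have him : |ξ.im| < 1 / 4 := (Complex.abs_im_le_norm ξ).trans_lt hξ
  have hpi := Real.pi_pos
  rw [abs_lt] at him
  left
  rw [expMap, Complex.exp_re]
  refine mul_pos (Real.exp_pos _) (Real.cos_pos_of_mem_Ioo ⟨?_, ?_⟩) <;>
  · simp only [Complex.mul_im, Complex.mul_re, Complex.re_ofNat, Complex.im_ofNat, Complex.ofReal_re,
      Complex.ofReal_im]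
    nlinarith

/-- Near `expMap ζ₀`, the map `onPlane f` is smooth when the lift of `f` is, although `polarLog` jumps
across the negative real axis. -/
theorem onPlane_eventuallyEq {X : Type*} (f : ℝ × UnitAddCircle → X) (ζ₀ : ℂ) :
    onPlane f =ᶠ[𝓝 (expMap ζ₀)] (fun ζ => f (coverC ζ)) ∘ localLog ζ₀ := by
  filter_upwards [isOpen_ne.mem_nhds (expMap_ne_zero ζ₀)] with z hz
  rw [Function.comp_apply, ← onPlane_expMap f, expMap_localLog ζ₀ hz]

theorem coverC_surjective : Function.Surjective coverC := by
  rintro ⟨s, t⟩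
  obtain ⟨t, rfl⟩ := QuotientAddGroup.mk_surjective t
  exact ⟨⟨s, t⟩, rfl⟩

theorem continuous_coverC : Continuous coverC :=
  Complex.continuous_re.prodMk ((AddCircle.continuous_mk' 1).comp Complex.continuous_im)

/-- Limits in `s`, uniform in `t`, are limits in `z = e^{2π(s + it)}`. -/
theorem tendsto_polarLog {l l' : Filter ℝ} {k : Filter ℂ} {X : Type*} {F : ℝ × ℝ → X} {c : Filter X}
    (hk : Tendsto (fun z : ℂ => ‖z‖) k l') (hl : Tendsto Real.log l' l)
    (hdiv : Tendsto (fun x => x / (2 * Real.pi)) l l)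
    (hF : Tendsto F (l ×ˢ 𝓝ˢ (Icc (-1 / 2) (1 / 2))) c) : Tendsto (F ∘ polarLog) k c := by
  refine hF.comp ((hdiv.comp (hl.comp hk)).prodMk (tendsto_principal.2 ?_ |>.mono_right
    principal_le_nhdsSet))
  refine Eventually.of_forall fun z => ?_
  have hpi := Real.pi_pos
  have h1 := Complex.neg_pi_lt_arg z
  have h2 := Complex.arg_le_pi z
  constructor
  · rw [le_div_iff₀ (by positivity)]; linarith
  · rw [div_le_iff₀ (by positivity)]; linarith

theorem tendsto_polarLog_zero {X : Type*} {F : ℝ × ℝ → X} {c : Filter X}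
    (hF : Tendsto F (atBot ×ˢ 𝓝ˢ (Icc (-1 / 2) (1 / 2))) c) : Tendsto (F ∘ polarLog) (𝓝[≠] 0) c :=
  tendsto_polarLog tendsto_norm_nhdsNE_zero Real.tendsto_log_nhdsGT_zero
    (tendsto_id.atBot_div_const Real.two_pi_pos) hF

theorem tendsto_polarLog_infty {X : Type*} {F : ℝ × ℝ → X} {c : Filter X}
    (hF : Tendsto F (atTop ×ˢ 𝓝ˢ (Icc (-1 / 2) (1 / 2))) c) :
    Tendsto (F ∘ polarLog) (cocompact ℂ) c :=
  tendsto_polarLog tendsto_norm_cocompact_atTop Real.tendsto_log_atTop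
    (tendsto_id.atTop_div_const Real.two_pi_pos) hF

theorem tendsto_prod_nhdsSet {X Z : Type*} [TopologicalSpace Z] {K : Set Z} (hK : IsCompact K)
    {l : Filter ℝ} {c : Filter X} {F : ℝ × Z → X} (h : ∀ t, Tendsto F (l ×ˢ 𝓝 t) c) :
    Tendsto F (l ×ˢ 𝓝ˢ K) c := by
  rw [hK.prod_nhdsSet_eq_biSup, tendsto_iSup]
  intro t
  rw [tendsto_iSup]
  exact fun _ => h t

/-! ### The ends of the punctured plane -/

section EndsOfCylinder

variable (Γ : Finset (ℝ × UnitAddCircle))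

/-- A point of the plane over a point of the cylinder. -/
def liftC (z : ℝ × UnitAddCircle) : ℂ := Function.surjInv coverC_surjective z

theorem coverC_liftC (z : ℝ × UnitAddCircle) : coverC (liftC z) = z :=
  Function.surjInv_eq coverC_surjective z

/-- The punctures of the domain, in `ℂP¹`: `∞`, `0` and the augmentation punctures. -/
def cylEnd : Option (Option Γ) → OnePoint ℂ
  | none => OnePoint.infty
  | some none => ((0 : ℂ) : OnePoint ℂ)
  | some (some z) => (expMap (liftC z.1) : OnePoint ℂ)

theorem cylEnd_injective : Function.Injective (cylEnd Γ) := by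
  have hinf : ∀ i, cylEnd Γ (some i) ≠ OnePoint.infty := by
    rintro (_ | z) <;> exact OnePoint.coe_ne_infty _
  have h0 : ∀ z : Γ, expMap (liftC z.1) ≠ 0 := fun z => expMap_ne_zero _
  rintro (_ | _ | z) (_ | _ | z') h
  · rfl
  · exact absurd h.symm (hinf _)
  · exact absurd h.symm (hinf _)
  · exact absurd h (hinf _)
  · rfl
  · exact absurd (OnePoint.coe_injective h).symm (h0 z')
  · exact absurd h (hinf _)
  · exact absurd (OnePoint.coe_injective h) (h0 z)
  · have := expMap_eq_iff.1 (OnePoint.coe_injective h)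
    rw [coverC_liftC, coverC_liftC] at this
    rw [Subtype.ext this]

theorem expMap_notMem_range_cylEnd {ζ : ℂ} :
    ((expMap ζ : ℂ) : OnePoint ℂ) ∉ range (cylEnd Γ) ↔ coverC ζ ∉ Γ := by
  rw [not_iff_not]
  constructor
  · rintro ⟨_ | _ | z, h⟩
    · exact absurd h.symm (OnePoint.coe_ne_infty _)
    · exact absurd (OnePoint.coe_injective h).symm (expMap_ne_zero ζ)
    · rw [← expMap_eq_iff.1 (OnePoint.coe_injective h), coverC_liftC]
      exact z.2
  · intro h
    refine ⟨some (some ⟨_, h⟩), ?_⟩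
    exact congrArg _ (expMap_eq_iff.2 (coverC_liftC _))

theorem exists_expMap_of_notMem_range {z : ℂ} (hz : (z : OnePoint ℂ) ∉ range (cylEnd Γ)) :
    ∃ ζ, expMap ζ = z ∧ coverC ζ ∉ Γ := by
  have h0 : z ≠ 0 := by
    rintro rfl
    exact hz ⟨some none, rfl⟩
  refine ⟨_, expMap_polarLog h0, ?_⟩
  rwa [← expMap_notMem_range_cylEnd, expMap_polarLog h0]

theorem isOpen_coverC_notMem : IsOpen {ζ | coverC ζ ∉ Γ} :=
  (Γ.finite_toSet.isClosed.isOpen_compl).preimage continuous_coverC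

/-- Near a point of `ℂP¹`, all other points are off the ends. -/
theorem eventually_notMem_range_cylEnd (x : OnePoint ℂ) :
    ∀ᶠ y in 𝓝[≠] x, y ∉ range (cylEnd Γ) := by
  have h : (range (cylEnd Γ) \ {x}).Finite := (finite_range _).subset sdiff_subset
  rw [eventually_nhdsWithin_iff]
  filter_upwards [h.isClosed.isOpen_compl.mem_nhds (by simp : x ∉ range (cylEnd Γ) \ {x})] with y hy hne
  exact fun hmem => hy ⟨hmem, hne⟩

end EndsOfCylinder

/-! ### Fluxes of the connection form at the ends -/

section Flux

variable {m : ℕ}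
  {Y : Type} [TopologicalSpace Y] [ChartedSpace (EuclideanSpace ℝ (Fin (2 * m + 1))) Y]
  {S : Type} [TopologicalSpace S] [ChartedSpace (EuclideanSpace ℝ (Fin (2 * m))) S]

theorem pullback_comp {n : ℕ} {M : Type} [TopologicalSpace M]
    [ChartedSpace (EuclideanSpace ℝ (Fin n)) M]
    {F G : Type*} [NormedAddCommGroup F] [NormedSpace ℝ F] [NormedAddCommGroup G] [NormedSpace ℝ G]
    (β : ∀ x : M, TangentSpace (𝓡 n) x →L[ℝ] ℝ) {u : F → M} {f : G → F} {f' : G →L[ℝ] F} {z : G}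
    (hu : MDifferentiableAt 𝓘(ℝ, F) (𝓡 n) u (f z)) (hf : HasFDerivAt f f' z) :
    pullback β (u ∘ f) z = (pullback β u (f z)).comp f' := by
  rw [pullback, (hu.hasMFDerivAt.comp z hf.hasMFDerivAt).mfderiv]
  rfl

theorem isOpen_compl_range_cylEnd (Γ : Finset (ℝ × UnitAddCircle)) :
    IsOpen {z : ℂ | (z : OnePoint ℂ) ∉ range (cylEnd Γ)} :=
  (finite_range _).isClosed.isOpen_compl.preimage OnePoint.continuous_coe

/-- The lift of a map on the cylinder to the plane. -/
def liftMap {X : Type*} (v : ℝ × UnitAddCircle → X) (ζ : ℂ) : X := v (coverC ζ)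

theorem onPlane_comp_expMap {X : Type*} (v : ℝ × UnitAddCircle → X) :
    onPlane v ∘ expMap = liftMap v := funext fun ζ => onPlane_expMap v ζ

theorem contMDiffOn_liftMap {Γ : Finset (ℝ × UnitAddCircle)} {v : ℝ × UnitAddCircle → Y}
    (hv : ContMDiffOn 𝓘(ℝ, ℝ × ℝ) (𝓡 (2 * m + 1)) ∞ (fun p => v (cover p)) {p | cover p ∉ Γ}) :
    ContMDiffOn 𝓘(ℝ, ℂ) (𝓡 (2 * m + 1)) ∞ (liftMap v) {ζ | coverC ζ ∉ Γ} :=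
  hv.comp (Complex.equivRealProdCLM.contDiff.contMDiff.contMDiffOn) fun _ h => h

theorem contMDiffOn_onPlane {Γ : Finset (ℝ × UnitAddCircle)} {v : ℝ × UnitAddCircle → Y}
    (hv : ContMDiffOn 𝓘(ℝ, ℂ) (𝓡 (2 * m + 1)) ∞ (liftMap v) {ζ | coverC ζ ∉ Γ}) :
    ContMDiffOn 𝓘(ℝ, ℂ) (𝓡 (2 * m + 1)) ∞ (onPlane v)
      {z : ℂ | (z : OnePoint ℂ) ∉ range (cylEnd Γ)} := by
  intro z hz
  obtain ⟨ζ, rfl, hζ⟩ := exists_expMap_of_notMem_range Γ hz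
  refine ContMDiffAt.contMDiffWithinAt ?_
  refine ContMDiffAt.congr_of_eventuallyEq ?_ (onPlane_eventuallyEq v ζ)
  have h1 : ContMDiffAt 𝓘(ℝ, ℂ) 𝓘(ℝ, ℂ) ∞ (localLog ζ) (expMap ζ) := by
    rw [contMDiffAt_iff_contDiffAt]
    refine contDiffAt_localLog ?_
    rw [div_self (expMap_ne_zero ζ)]
    exact Complex.one_mem_slitPlane
  refine ContMDiffAt.comp (expMap ζ) ?_ h1
  rw [localLog_self]
  exact hv.contMDiffAt ((isOpen_coverC_notMem Γ).mem_nhds hζ)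

/-- The connection form evaluated on the derivatives of loops which converge to a `k`-fold fibre. -/
theorem tendsto_pullback_loops [IsManifold (𝓡 (2 * m + 1)) ∞ Y] (P : ReebCircleBundle m Y S) {K : ℝ}
    {Θ : ∀ y : Y, TangentSpace (𝓡 (2 * m + 1)) y →L[ℝ] ℝ} (hΘ : P.IsConnectionForm K Θ)
    {g : ℝ → ℝ → Y} {l : Filter ℝ} {γ : ℝ → Y} {k : ℕ} (hg : LoopsTendsto (m := m) g l γ)
    (hγ : ∀ t, HasMFDerivAt 𝓘(ℝ, ℝ) (𝓡 (2 * m + 1)) γ t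
      ((1 : ℝ →L[ℝ] ℝ).smulRight (((k : ℝ) * P.T₀) • P.R (γ t)))) :
    Tendsto (fun p : ℝ × ℝ => pullback Θ (g p.1) p.2 1) (l ×ˢ 𝓝ˢ (Icc (-1 / 2) (1 / 2)))
      (𝓝 (-k)) := by
  refine tendsto_prod_nhdsSet isCompact_Icc fun t => ?_
  have h1 := (hΘ.smooth.continuous_apply.tendsto _).comp (hg t)
  have h2 : Θ (γ t) (mfderiv 𝓘(ℝ, ℝ) (𝓡 (2 * m + 1)) γ t (1 : ℝ)) = -k := by
    rw [(hγ t).mfderiv]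
    change Θ (γ t) ((1 : ℝ) • ((k : ℝ) * P.T₀) • P.R (γ t)) = -k
    have := hΘ.generator (γ t)
    rw [map_neg, map_smul, smul_eq_mul] at this
    rw [one_smul, map_smul, smul_eq_mul]
    linear_combination (-(k : ℝ)) * this
  rw [← h2]
  exact h1

theorem IsHamOrbit.hasMFDerivAt {P : ReebCircleBundle m Y S} {h : ℝ → ℝ} {k : ℕ} {c : ℝ} {γ : ℝ → Y}
    (hγ : IsHamOrbit P h k c γ) (t : ℝ) : HasMFDerivAt 𝓘(ℝ, ℝ) (𝓡 (2 * m + 1)) γ t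
      ((1 : ℝ →L[ℝ] ℝ).smulRight (((k : ℝ) * P.T₀) • P.R (γ t))) := by
  have := hγ.2.2.2 t
  have h2 : (hamVF P h c (γ t)).2 = ((k : ℝ) * P.T₀) • P.R (γ t) := by
    rw [← hγ.2.1]
    rfl
  rw [← h2]
  exact this

variable {Γ : Finset (ℝ × UnitAddCircle)} {v : ℝ × UnitAddCircle → Y}

theorem mdifferentiableAt_onPlane
    (hv : ContMDiffOn 𝓘(ℝ, ℂ) (𝓡 (2 * m + 1)) ∞ (liftMap v) {ζ | coverC ζ ∉ Γ})
    {z : ℂ} (hz : (z : OnePoint ℂ) ∉ range (cylEnd Γ)) :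
    MDifferentiableAt 𝓘(ℝ, ℂ) (𝓡 (2 * m + 1)) (onPlane v) z :=
  ((contMDiffOn_onPlane hv).contMDiffAt ((isOpen_compl_range_cylEnd Γ).mem_nhds hz)).mdifferentiableAt (by simp)

theorem mdifferentiableAt_liftMap
    (hv : ContMDiffOn 𝓘(ℝ, ℂ) (𝓡 (2 * m + 1)) ∞ (liftMap v) {ζ | coverC ζ ∉ Γ})
    {ζ : ℂ} (hζ : coverC ζ ∉ Γ) :
    MDifferentiableAt 𝓘(ℝ, ℂ) (𝓡 (2 * m + 1)) (liftMap v) ζ :=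
  (hv.contMDiffAt ((isOpen_coverC_notMem Γ).mem_nhds hζ)).mdifferentiableAt (by simp)

theorem pullback_liftMap (Θ : ∀ y : Y, TangentSpace (𝓡 (2 * m + 1)) y →L[ℝ] ℝ)
    (hv : ContMDiffOn 𝓘(ℝ, ℂ) (𝓡 (2 * m + 1)) ∞ (liftMap v) {ζ | coverC ζ ∉ Γ})
    {ζ : ℂ} (hζ : coverC ζ ∉ Γ) (η : ℂ) :
    pullback Θ (liftMap v) ζ η =
      pullback Θ (onPlane v) (expMap ζ) (2 * Real.pi * expMap ζ * η) := by
  rw [← onPlane_comp_expMap, pullback_comp Θ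
    (mdifferentiableAt_onPlane hv ((expMap_notMem_range_cylEnd Γ).2 hζ))
    ((hasDerivAt_expMap ζ).hasFDerivAt.restrictScalars ℝ)]
  simp [mul_comm]

theorem pullback_loop (Θ : ∀ y : Y, TangentSpace (𝓡 (2 * m + 1)) y →L[ℝ] ℝ)
    (hv : ContMDiffOn 𝓘(ℝ, ℂ) (𝓡 (2 * m + 1)) ∞ (liftMap v) {ζ | coverC ζ ∉ Γ})
    {c : ℝ → ℂ} {c' : ℂ} {t : ℝ} (hc : HasDerivAt c c' t) (ht : coverC (c t) ∉ Γ) :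
    pullback Θ (fun t => v (coverC (c t))) t 1 =
      pullback Θ (onPlane v) (expMap (c t)) (2 * Real.pi * expMap (c t) * c') := by
  rw [← pullback_liftMap Θ hv ht]
  have h1 := pullback_comp Θ (mdifferentiableAt_liftMap hv ht) hc.hasFDerivAt
  change pullback Θ (liftMap v ∘ c) t 1 = _
  rw [h1]
  simp

/-- The angular component about `0` of the 1-form `u^*Θ` on the plane. -/
theorem pullback_angular (Θ : ∀ y : Y, TangentSpace (𝓡 (2 * m + 1)) y →L[ℝ] ℝ)
    (hv : ContMDiffOn 𝓘(ℝ, ℂ) (𝓡 (2 * m + 1)) ∞ (liftMap v) {ζ | coverC ζ ∉ Γ})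
    {z : ℂ} (hz : (z : OnePoint ℂ) ∉ range (cylEnd Γ)) :
    pullback Θ (onPlane v) z (Complex.I * z) = (2 * Real.pi)⁻¹ *
      pullback Θ (fun t : ℝ => v (cover ((polarLog z).1, t))) (polarLog z).2 1 := by
  have h0 : z ≠ 0 := by
    rintro rfl
    exact hz ⟨some none, rfl⟩
  have hexp := expMap_polarLog h0
  have hc : HasDerivAt (fun t : ℝ => ((polarLog z).1 + t * Complex.I : ℂ)) Complex.I
      (polarLog z).2 := by
    simpa using ((hasDerivAt_id (polarLog z).2).ofReal_comp.mul_const Complex.I).const_add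
      ((polarLog z).1 : ℂ)
  have h1 := pullback_loop Θ hv hc (by
    rw [← expMap_notMem_range_cylEnd, hexp]
    exact hz)
  have h2 : (fun t : ℝ => v (coverC ((polarLog z).1 + t * Complex.I))) =
      fun t : ℝ => v (cover ((polarLog z).1, t)) := by
    funext t
    simp [coverC]
  rw [h2, hexp] at h1
  have h3 : (2 * Real.pi * z * Complex.I : ℂ) = (2 * Real.pi : ℝ) • (Complex.I * z) := by
    rw [Complex.real_smul]
    push_cast
    ring
  rw [h1, h3, map_smul, smul_eq_mul, inv_mul_cancel_left₀ Real.two_pi_pos.ne']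

/-- The angular component about a puncture of the 1-form `u^*Θ` on the plane, in the coordinate
of the cylinder centred at the puncture. -/
theorem pullback_angular_puncture (Θ : ∀ y : Y, TangentSpace (𝓡 (2 * m + 1)) y →L[ℝ] ℝ)
    (hv : ContMDiffOn 𝓘(ℝ, ℂ) (𝓡 (2 * m + 1)) ∞ (liftMap v) {ζ | coverC ζ ∉ Γ})
    (z : ℝ × UnitAddCircle) {ξ : ℂ} (h0 : ξ ≠ 0)
    (hξ : (expMap (liftC z + ξ) : OnePoint ℂ) ∉ range (cylEnd Γ)) :
    pullback Θ (onPlane v) (expMap (liftC z + ξ))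
      (2 * Real.pi * expMap (liftC z + ξ) * (Complex.I * ξ)) = (2 * Real.pi)⁻¹ *
      pullback Θ (fun t : ℝ => v (aroundPuncture z (polarLog ξ).1 t)) (polarLog ξ).2 1 := by
  have hexp := expMap_polarLog h0
  have hc : HasDerivAt (fun t : ℝ => liftC z + expMap ((polarLog ξ).1 + t * Complex.I))
      (2 * Real.pi * ξ * Complex.I) (polarLog ξ).2 := by
    have h1 : HasDerivAt (fun t : ℝ => ((polarLog ξ).1 + t * Complex.I : ℂ)) Complex.I
        (polarLog ξ).2 := by
      simpa using ((hasDerivAt_id (polarLog ξ).2).ofReal_comp.mul_const Complex.I).const_add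
        ((polarLog ξ).1 : ℂ)
    have h2 := hasDerivAt_expMap (((polarLog ξ).1 : ℂ) + ((polarLog ξ).2 : ℝ) * Complex.I)
    rw [hexp] at h2
    exact ((h2.comp (polarLog ξ).2 h1)).const_add _
  have h1 := pullback_loop Θ hv hc (by
    rw [← expMap_notMem_range_cylEnd, hexp]
    exact hξ)
  have h2 : (fun t : ℝ => v (coverC (liftC z + expMap ((polarLog ξ).1 + t * Complex.I)))) =
      fun t : ℝ => v (aroundPuncture z (polarLog ξ).1 t) := by
    funext t
    congr 1
    conv_rhs => rw [← coverC_liftC z]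
    simp only [coverC, aroundPuncture, cover, expMap, Complex.add_re, Complex.add_im,
      Complex.exp_re, Complex.exp_im, Prod.mk.injEq]
    constructor
    · simp
    · simp
  rw [h2, hexp] at h1
  have h3 : (2 * Real.pi * expMap (liftC z + ξ) * (2 * Real.pi * ξ * Complex.I) : ℂ) =
      (2 * Real.pi : ℝ) • (2 * Real.pi * expMap (liftC z + ξ) * (Complex.I * ξ)) := by
    rw [Complex.real_smul]
    push_cast
    ring
  rw [h1, h3, map_smul, smul_eq_mul, inv_mul_cancel_left₀ Real.two_pi_pos.ne']

end Flux

section FluxAtEnds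

variable {m : ℕ}
  {Y : Type} [TopologicalSpace Y] [ChartedSpace (EuclideanSpace ℝ (Fin (2 * m + 1))) Y]
  {S : Type} [TopologicalSpace S] [ChartedSpace (EuclideanSpace ℝ (Fin (2 * m))) S]

/-- The 1-form `-u^*Θ` on the plane, where `u` is the `Y`-component of a map on the cylinder. -/
def planeForm (Θ : ∀ y : Y, TangentSpace (𝓡 (2 * m + 1)) y →L[ℝ] ℝ) (v : ℝ × UnitAddCircle → Y)
    (z : ℂ) : ℂ →L[ℝ] ℝ := -pullback Θ (onPlane v) z

variable {Γ : Finset (ℝ × UnitAddCircle)} {v : ℝ × UnitAddCircle → Y}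
  {Θ : ∀ y : Y, TangentSpace (𝓡 (2 * m + 1)) y →L[ℝ] ℝ}

/-- The radius `1 / 4` is one on which `ξ ↦ expMap (ζ + ξ)` is injective for every `ζ`. -/
theorem eventually_notMem_range_of_injOn {E : ℂ → ℂ} (hE : ContinuousAt E 0)
    (hinj : InjOn E (Metric.ball 0 (1 / 4))) :
    ∃ r > 0, r ≤ 1 / 4 ∧ ∀ ξ ∈ Metric.ball (0 : ℂ) r, ξ ≠ 0 →
      (E ξ : OnePoint ℂ) ∉ range (cylEnd Γ) := by
  have h1 : ContinuousAt (fun ξ => (E ξ : OnePoint ℂ)) 0 :=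
    OnePoint.continuous_coe.continuousAt.comp hE
  have h2 := h1.eventually (eventually_nhdsWithin_iff.1
    (eventually_notMem_range_cylEnd Γ (E 0 : OnePoint ℂ)))
  obtain ⟨r, hr, h⟩ := Metric.eventually_nhds_iff_ball.1 h2
  refine ⟨min r (1 / 4), by positivity, min_le_right _ _, fun ξ hξ h0 => ?_⟩
  refine h ξ (Metric.ball_subset_ball (min_le_left _ _) hξ) fun heq => h0 ?_
  exact hinj (Metric.ball_subset_ball (min_le_right _ _) hξ) (Metric.mem_ball_self (by norm_num))
    (OnePoint.coe_injective heq)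

variable [IsManifold (𝓡 (2 * m + 1)) ∞ Y]

theorem contDiffAt_planeForm (hΘ : SmoothOneForm Θ)
    (hv : ContMDiffOn 𝓘(ℝ, ℂ) (𝓡 (2 * m + 1)) ∞ (liftMap v) {ζ | coverC ζ ∉ Γ}) {z : ℂ}
    (hz : (z : OnePoint ℂ) ∉ range (cylEnd Γ)) : ContDiffAt ℝ ∞ (planeForm Θ v) z :=
  (contDiffAt_pullback hΘ (isOpen_compl_range_cylEnd Γ) (contMDiffOn_onPlane hv) hz).neg

/-- The curvature equation for `Θ`, pulled back to the plane. -/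
theorem planeExtD_planeForm {P : ReebCircleBundle m Y S} {K : ℝ} (hΘ : P.IsConnectionForm K Θ)
    (hv : ContMDiffOn 𝓘(ℝ, ℂ) (𝓡 (2 * m + 1)) ∞ (liftMap v) {ζ | coverC ζ ∉ Γ}) {z : ℂ}
    (hz : (z : OnePoint ℂ) ∉ range (cylEnd Γ)) :
    planeExtD (planeForm Θ v) z = K * P.areaAt (P.proj ∘ onPlane v) z := by
  have h1 := fderiv_pullback_sub hΘ.smooth (isOpen_compl_range_cylEnd Γ) (contMDiffOn_onPlane hv) hz
    (1 : ℂ) Complex.I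
  rw [hΘ.curvature] at h1
  rw [P.areaAt_proj_comp (mdifferentiableAt_onPlane hv hz), planeExtD]
  have h2 : fderiv ℝ (planeForm Θ v) z = -fderiv ℝ (pullback Θ (onPlane v)) z := by
    unfold planeForm
    exact fderiv_neg
  rw [h2]
  simp only [neg_apply]
  linear_combination -h1

/-- The flux at the positive end is the multiplicity of the limit orbit. -/
theorem hasFlux_plus {P : ReebCircleBundle m Y S} {K : ℝ} (hΘ : P.IsConnectionForm K Θ)
    (hv : ContMDiffOn 𝓘(ℝ, ℂ) (𝓡 (2 * m + 1)) ∞ (liftMap v) {ζ | coverC ζ ∉ Γ}) {γ : ℝ → Y} {k : ℕ}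
    (hg : LoopsTendsto (m := m) (fun s t => v (cover (s, t))) atTop γ)
    (hγ : ∀ t, HasMFDerivAt 𝓘(ℝ, ℝ) (𝓡 (2 * m + 1)) γ t
      ((1 : ℝ →L[ℝ] ℝ).smulRight (((k : ℝ) * P.T₀) • P.R (γ t)))) :
    HasFlux (planeForm Θ v) OnePoint.infty k := by
  have hev : ∀ᶠ z in cocompact ℂ, ((z : ℂ) : OnePoint ℂ) ∉ range (cylEnd Γ) := by
    have h1 := eventually_nhdsWithin_iff.1 (eventually_notMem_range_cylEnd Γ OnePoint.infty)
    have h2 := (tendsto_comap (f := ((↑) : ℂ → OnePoint ℂ))).eventually h1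
    rw [OnePoint.comap_coe_nhds_infty, coclosedCompact_eq_cocompact] at h2
    filter_upwards [h2] with z hz using hz (OnePoint.coe_ne_infty z)
  have h1 := ((tendsto_polarLog_infty (tendsto_pullback_loops P hΘ hg hγ)).const_mul
    (2 * Real.pi)⁻¹).neg
  have h2 : Tendsto (fun z => planeForm Θ v z (Complex.I * z)) (cocompact ℂ)
      (𝓝 (-((2 * Real.pi)⁻¹ * -(k : ℝ)))) := by
    refine h1.congr' ?_
    filter_upwards [hev] with z hz
    rw [planeForm, neg_apply, pullback_angular Θ hv hz]
    rfl
  have h3 := hasFlux_infty (hev.mono fun z hz => (contDiffAt_planeForm hΘ.smooth hv hz).continuousAt) h2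
  convert h3 using 1
  field_simp

/-- The flux at the negative end is minus the multiplicity of the limit orbit. -/
theorem hasFlux_minus {P : ReebCircleBundle m Y S} {K : ℝ} (hΘ : P.IsConnectionForm K Θ)
    (hv : ContMDiffOn 𝓘(ℝ, ℂ) (𝓡 (2 * m + 1)) ∞ (liftMap v) {ζ | coverC ζ ∉ Γ}) {γ : ℝ → Y} {k : ℕ}
    (hg : LoopsTendsto (m := m) (fun s t => v (cover (s, t))) atBot γ)
    (hγ : ∀ t, HasMFDerivAt 𝓘(ℝ, ℝ) (𝓡 (2 * m + 1)) γ t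
      ((1 : ℝ →L[ℝ] ℝ).smulRight (((k : ℝ) * P.T₀) • P.R (γ t)))) :
    HasFlux (planeForm Θ v) ((0 : ℂ) : OnePoint ℂ) (-k) := by
  obtain ⟨r, hr, -, hr'⟩ := eventually_notMem_range_of_injOn (Γ := Γ) (E := fun ξ => ξ)
    continuousAt_id (injOn_id _)
  have h1 := ((tendsto_polarLog_zero (tendsto_pullback_loops P hΘ hg hγ)).const_mul
    (2 * Real.pi)⁻¹).neg
  have h2 : Tendsto (fun z => planeForm Θ v z (1 * (Complex.I * z))) (𝓝[≠] 0)
      (𝓝 (-((2 * Real.pi)⁻¹ * -(k : ℝ)))) := by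
    refine h1.congr' ?_
    filter_upwards [inter_mem_nhdsWithin {0}ᶜ (Metric.ball_mem_nhds 0 hr)] with z hz
    rw [planeForm, neg_apply, one_mul, pullback_angular Θ hv (hr' z hz.2 hz.1)]
    rfl
  have h3 := hasFlux_of_chart (E := fun ξ => ξ) (E' := fun _ => 1) (L := fun ξ => ξ) hr
    (fun ξ _ => hasDerivAt_id ξ) continuousOn_const (fun _ _ => rfl)
    (by rw [image_id']; exact Metric.isOpen_ball) (fun ξ _ => contDiffAt_id)
    (fun ξ hξ h0 => (contDiffAt_planeForm hΘ.smooth hv (hr' ξ hξ h0)).continuousAt) h2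
  convert h3 using 1
  field_simp

/-- The flux at an augmentation puncture is minus the multiplicity of the limit orbit. The local
coordinate is the one of the cylinder, in which the convergence of loops is prescribed. -/
theorem hasFlux_puncture {P : ReebCircleBundle m Y S} {K : ℝ} (hΘ : P.IsConnectionForm K Θ)
    (hv : ContMDiffOn 𝓘(ℝ, ℂ) (𝓡 (2 * m + 1)) ∞ (liftMap v) {ζ | coverC ζ ∉ Γ}) {γ : ℝ → Y} {k : ℕ}
    (z : ℝ × UnitAddCircle)
    (hg : LoopsTendsto (m := m) (fun ρ θ => v (aroundPuncture z ρ θ)) atBot γ)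
    (hγ : ∀ t, HasMFDerivAt 𝓘(ℝ, ℝ) (𝓡 (2 * m + 1)) γ t
      ((1 : ℝ →L[ℝ] ℝ).smulRight (((k : ℝ) * P.T₀) • P.R (γ t)))) :
    HasFlux (planeForm Θ v) (expMap (liftC z) : OnePoint ℂ) (-k) := by
  set E : ℂ → ℂ := fun ξ => expMap (liftC z + ξ)
  have hE_apply : ∀ ξ, E ξ = expMap (liftC z + ξ) := fun _ => rfl
  have hE : ∀ ξ, HasDerivAt E (2 * Real.pi * E ξ) ξ := fun ξ =>
    ((hasDerivAt_expMap _).comp_const_add (liftC z) ξ)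
  have hcont : Continuous E := continuous_iff_continuousAt.2 fun ξ => (hE ξ).continuousAt
  have hL : ∀ ξ ∈ Metric.ball (0 : ℂ) (1 / 4), localLog (liftC z) (E ξ) - liftC z = ξ := by
    intro ξ hξ
    rw [hE_apply, localLog_expMap_add (mem_ball_zero_iff.1 hξ), add_sub_cancel_left]
  have hinj : InjOn E (Metric.ball 0 (1 / 4)) := fun x hx y hy h => by rw [← hL x hx, ← hL y hy, h]
  have hopen : IsOpenMap E := isOpenMap_of_hasStrictDerivAt (f' := fun ξ => 2 * Real.pi * E ξ)
    (fun ξ => by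
      have : Differentiable ℂ E := fun ξ => (hE ξ).differentiableAt
      have h := (this.analyticAt ξ).hasStrictDerivAt
      rwa [(hE ξ).deriv] at h)
    fun ξ => mul_ne_zero two_pi_ne_zero' (expMap_ne_zero _)
  obtain ⟨r, hr, hr4, hr'⟩ := eventually_notMem_range_of_injOn (Γ := Γ) hcont.continuousAt hinj
  have hsub := Metric.ball_subset_ball (x := (0 : ℂ)) hr4
  have h1 := ((tendsto_polarLog_zero (tendsto_pullback_loops P hΘ hg hγ)).const_mul
    (2 * Real.pi)⁻¹).neg
  have h2 : Tendsto (fun ξ => planeForm Θ v (E ξ) (2 * Real.pi * E ξ * (Complex.I * ξ))) (𝓝[≠] 0)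
      (𝓝 (-((2 * Real.pi)⁻¹ * -(k : ℝ)))) := by
    refine h1.congr' ?_
    filter_upwards [inter_mem_nhdsWithin {0}ᶜ (Metric.ball_mem_nhds 0 hr)] with ξ hξ
    rw [planeForm, neg_apply, pullback_angular_puncture Θ hv z hξ.1 (hr' ξ hξ.2 hξ.1)]
    rfl
  have h3 := hasFlux_of_chart (E := E) (E' := fun ξ => 2 * Real.pi * E ξ)
    (L := fun x => localLog (liftC z) x - liftC z) hr
    (fun ξ _ => hE ξ) (continuous_const.mul hcont).continuousOn (fun ξ hξ => hL ξ (hsub hξ))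
    (hopen _ Metric.isOpen_ball)
    (fun ξ hξ => by
      refine (contDiffAt_localLog ?_).sub contDiffAt_const
      rw [hE_apply, expMap_add, mul_div_cancel_left₀ _ (expMap_ne_zero _)]
      exact expMap_mem_slitPlane (mem_ball_zero_iff.1 (hsub hξ)))
    (fun ξ hξ h0 => (contDiffAt_planeForm hΘ.smooth hv (hr' ξ hξ h0)).continuousAt) h2
  have h4 : E 0 = expMap (liftC z) := by rw [hE_apply, add_zero]
  rw [h4] at h3
  convert h3 using 1
  field_simp

end FluxAtEnds

/-! ### The projected sphere -/

section Sphere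

variable {m : ℕ}
  {Y : Type} [TopologicalSpace Y] [ChartedSpace (EuclideanSpace ℝ (Fin (2 * m + 1))) Y]
  {S : Type} [TopologicalSpace S] [ChartedSpace (EuclideanSpace ℝ (Fin (2 * m))) S]

theorem mfderiv_liftMap_apply {v : ℝ × UnitAddCircle → Y} {ζ : ℂ}
    (hv : MDifferentiableAt 𝓘(ℝ, ℝ × ℝ) (𝓡 (2 * m + 1)) (fun p => v (cover p)) (ζ.re, ζ.im)) (η : ℂ) :
    mfderiv 𝓘(ℝ, ℂ) (𝓡 (2 * m + 1)) (liftMap v) ζ η =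
      mfderiv 𝓘(ℝ, ℝ × ℝ) (𝓡 (2 * m + 1)) (fun p => v (cover p)) (ζ.re, ζ.im)
        ((η.re, η.im) : ℝ × ℝ) := by
  have h1 : HasMFDerivAt 𝓘(ℝ, ℂ) 𝓘(ℝ, ℝ × ℝ) Complex.equivRealProdCLM ζ
      (Complex.equivRealProdCLM : ℂ →L[ℝ] ℝ × ℝ) :=
    (Complex.equivRealProdCLM.hasFDerivAt).hasMFDerivAt
  have h2 : HasMFDerivAt 𝓘(ℝ, ℝ × ℝ) (𝓡 (2 * m + 1)) (fun p => v (cover p))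
      (Complex.equivRealProdCLM ζ) _ := hv.hasMFDerivAt
  have h3 := h2.comp ζ h1
  have h4 : HasMFDerivAt 𝓘(ℝ, ℂ) (𝓡 (2 * m + 1)) (liftMap v) ζ _ := h3
  rw [h4.mfderiv]
  rfl

/-- The projection to `S` of a Floer cylinder, in the coordinate `s + it`, has nonnegative area
density, and its derivative vanishes where the density does. -/
theorem areaAt_proj_liftMap [IsManifold (𝓡 (2 * m + 1)) ∞ Y] {P : ReebCircleBundle m Y S} {h : ℝ → ℝ}
    {J : ∀ y : Y, (ℝ × TangentSpace (𝓡 (2 * m + 1)) y) →L[ℝ]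
      (ℝ × TangentSpace (𝓡 (2 * m + 1)) y)} (hJ : IsAdmissibleJ P J)
    {Γ : Finset (ℝ × UnitAddCircle)} {b : ℝ × UnitAddCircle → ℝ} {v : ℝ × UnitAddCircle → Y}
    {kp km : ℕ} {κ : ℝ × UnitAddCircle → ℕ} (hv : IsPuncturedFloerCylinder P h J Γ b v kp km κ)
    {ζ : ℂ} (hζ : coverC ζ ∉ Γ) :
    0 ≤ P.areaAt (P.proj ∘ liftMap v) ζ ∧ (P.areaAt (P.proj ∘ liftMap v) ζ = 0 →
      mfderiv 𝓘(ℝ, ℂ) (𝓡 (2 * m)) (P.proj ∘ liftMap v) ζ = 0) := by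
  have hopen : IsOpen {p : ℝ × ℝ | cover p ∉ Γ} :=
    (Γ.finite_toSet.isClosed.isOpen_compl).preimage
      (continuous_fst.prodMk ((AddCircle.continuous_mk' 1).comp continuous_snd))
  have hd := (hv.smooth_v.contMDiffAt (hopen.mem_nhds hζ)).mdifferentiableAt (by simp)
  have hl := mdifferentiableAt_liftMap (contMDiffOn_liftMap hv.smooth_v) hζ
  have h1 := P.ωS_nonneg_of_floer hJ (v (cover (ζ.re, ζ.im))) _ _ _ _ _ (hv.floer (ζ.re, ζ.im) hζ)
  have e1 := mfderiv_liftMap_apply hd 1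
  have e2 := mfderiv_liftMap_apply hd Complex.I
  rw [P.areaAt_proj_comp hl, e1, e2]
  refine ⟨h1.1, fun h0 => ?_⟩
  obtain ⟨hs, ht⟩ := h1.2 h0
  rw [mfderiv_comp ζ (P.mdifferentiableAt_proj _) hl]
  let D : ℂ →L[ℝ] EuclideanSpace ℝ (Fin (2 * m)) :=
    (mfderiv (𝓡 (2 * m + 1)) (𝓡 (2 * m)) P.proj (liftMap v ζ)).comp
      (mfderiv 𝓘(ℝ, ℂ) (𝓡 (2 * m + 1)) (liftMap v) ζ)
  have hD1 : D 1 = 0 := by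
    refine Eq.trans ?_ hs
    exact congrArg (mfderiv (𝓡 (2 * m + 1)) (𝓡 (2 * m)) P.proj (liftMap v ζ)) e1
  have hDI : D Complex.I = 0 := by
    refine Eq.trans ?_ ht
    exact congrArg (mfderiv (𝓡 (2 * m + 1)) (𝓡 (2 * m)) P.proj (liftMap v ζ)) e2
  have hD : D = 0 := by
    ext1 z
    have : z = z.re • (1 : ℂ) + z.im • Complex.I := by apply Complex.ext <;> simp
    rw [this, map_add, map_smul, map_smul, hD1, hDI]
    simp
  exact hD

/-- A differentiable map to a manifold whose derivative vanishes on a connected open set is constant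
there. -/
theorem eqOn_const_of_mfderiv_eq_zero {n : ℕ} {M : Type} [TopologicalSpace M] [T2Space M]
    [ChartedSpace (EuclideanSpace ℝ (Fin n)) M] [IsManifold (𝓡 n) ∞ M] {f : ℂ → M} {U : Set ℂ}
    (hU : IsOpen U) (hconn : IsPreconnected U)
    (hf : ∀ z ∈ U, MDifferentiableAt 𝓘(ℝ, ℂ) (𝓡 n) f z)
    (hf' : ∀ z ∈ U, mfderiv 𝓘(ℝ, ℂ) (𝓡 n) f z = 0) {z₀ : ℂ} (hz₀ : z₀ ∈ U) :
    ∀ z ∈ U, f z = f z₀ := by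
  have hloc : ∀ z ∈ U, ∀ᶠ z' in 𝓝 z, f z' = f z := by
    intro z hz
    set x := f z
    have hcont : ContinuousAt f z := (hf z hz).continuousAt
    obtain ⟨r, hr, hball⟩ := Metric.eventually_nhds_iff_ball.1 ((hU.eventually_mem hz).and
      (hcont.preimage_mem_nhds ((isOpen_extChartAt_source (I := 𝓡 n) x).mem_nhds
        (mem_extChartAt_source x))))
    have hder : ∀ z' ∈ Metric.ball z r,
        HasFDerivAt (fun z => extChartAt (𝓡 n) x (f z)) (0 : ℂ →L[ℝ] EuclideanSpace ℝ (Fin n)) z' := by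
      intro z' hz'
      have h1 := ((mdifferentiableAt_extChartAt (I := 𝓡 n)
        (by simpa using (hball z' hz').2)).hasMFDerivAt).comp z' (hf z' (hball z' hz').1).hasMFDerivAt
      rw [hf' z' (hball z' hz').1] at h1
      have h2 := h1.hasFDerivAt
      rw [ContinuousLinearMap.comp_zero] at h2
      exact h2
    filter_upwards [Metric.ball_mem_nhds z hr] with z' hz'
    have h3 : extChartAt (𝓡 n) x (f z') = extChartAt (𝓡 n) x (f z) :=
      (convex_ball z r).is_const_of_fderivWithin_eq_zero (𝕜 := ℝ)
        (fun y hy => (hder y hy).differentiableAt.differentiableWithinAt)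
        (fun y hy => by
          rw [fderivWithin_of_isOpen Metric.isOpen_ball hy]
          exact (hder y hy).fderiv) hz' (Metric.mem_ball_self hr)
    exact (extChartAt (𝓡 n) x).injOn (hball z' hz').2 (mem_extChartAt_source x) h3
  -- The set where `f` takes the value `f z₀` is open and relatively closed in `U`.
  set A := {z | z ∈ U ∧ f z = f z₀}
  have hA : IsOpen A := by
    rw [isOpen_iff_mem_nhds]
    rintro z ⟨hz, hfz⟩
    filter_upwards [hU.mem_nhds hz, hloc z hz] with z' h1 h2 using ⟨h1, h2.trans hfz⟩
  have hsub : U ⊆ A := by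
    refine hconn.subset_of_closure_inter_subset hA ⟨z₀, hz₀, hz₀, rfl⟩ ?_
    rintro z ⟨hzA, hz⟩
    refine ⟨hz, ?_⟩
    obtain ⟨z', ⟨-, h1⟩, h2⟩ := ((mem_closure_iff_frequently.1 hzA).and_eventually (hloc z hz)).exists
    exact h2.symm.trans h1
  exact fun z hz => (hsub hz).2

/-- Constant maps act trivially on `H₂`. -/
theorem H2map_eq_zero_of_const {X X' : Type} [TopologicalSpace X] [TopologicalSpace X'] (f : C(X, X'))
    {x : X'} (hf : ∀ y, f y = x) (c : H2 X) : H2map f c = 0 := by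
  let F := (AlgebraicTopology.singularHomologyFunctor (ModuleCat.{0} ℤ) 2).obj (ModuleCat.of ℤ ℤ)
  -- A constant map factors through a point, whose second homology vanishes.
  let p : C(X, PUnit.{1}) := ⟨fun _ => PUnit.unit, continuous_const⟩
  let q : C(PUnit.{1}, X') := ⟨fun _ => x, continuous_const⟩
  have h1 : TopCat.ofHom f = CategoryTheory.CategoryStruct.comp (TopCat.ofHom p) (TopCat.ofHom q) := by
    ext y
    exact hf y
  have h2 : CategoryTheory.Limits.IsZero (F.obj (TopCat.of PUnit.{1})) :=
    AlgebraicTopology.isZero_singularHomologyFunctor_of_totallyDisconnectedSpace _ 2 _ _ two_ne_zero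
  have h3 : F.map (TopCat.ofHom f) = 0 := by
    rw [h1, F.map_comp, h2.eq_of_tgt (F.map (TopCat.ofHom p)) 0, CategoryTheory.Limits.zero_comp]
  have h4 : H2map f = (F.map (TopCat.ofHom f)).hom := rfl
  rw [h4, h3]
  rfl

theorem IsProjection.eqOn {P : ReebCircleBundle m Y S} {Γ : Finset (ℝ × UnitAddCircle)}
    {v : ℝ × UnitAddCircle → Y} {w : C(OnePoint ℂ, S)} (hw : IsProjection P Γ v w) {z : ℂ}
    (hz : (z : OnePoint ℂ) ∉ range (cylEnd Γ)) : w z = P.proj (onPlane v z) := by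
  obtain ⟨ζ, rfl, hζ⟩ := exists_expMap_of_notMem_range Γ hz
  have h1 := hw (ζ.re, ζ.im) hζ
  rw [toSphere, Complex.re_add_im] at h1
  rw [onPlane_expMap]
  exact h1

theorem IsProjection.eventuallyEq {P : ReebCircleBundle m Y S} {Γ : Finset (ℝ × UnitAddCircle)}
    {v : ℝ × UnitAddCircle → Y} {w : C(OnePoint ℂ, S)} (hw : IsProjection P Γ v w) {z : ℂ}
    (hz : (z : OnePoint ℂ) ∉ range (cylEnd Γ)) :
    (fun z : ℂ => w z) =ᶠ[𝓝 z] P.proj ∘ onPlane v := by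
  filter_upwards [(isOpen_compl_range_cylEnd Γ).mem_nhds hz] with z' hz' using hw.eqOn hz'

theorem isPreconnected_compl_range_cylEnd (Γ : Finset (ℝ × UnitAddCircle)) :
    IsPreconnected {z : ℂ | (z : OnePoint ℂ) ∉ range (cylEnd Γ)} ∧
      Dense {z : ℂ | (z : OnePoint ℂ) ∉ range (cylEnd Γ)} := by
  have hfin : ((↑) ⁻¹' range (cylEnd Γ) : Set ℂ).Finite :=
    (finite_range _).preimage OnePoint.coe_injective.injOn
  refine ⟨?_, hfin.countable.dense_compl ℝ⟩
  exact (hfin.countable.isPathConnected_compl_of_one_lt_rank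
    (by rw [Complex.rank_real_complex]; norm_num)).isConnected.isPreconnected

variable [IsManifold (𝓡 (2 * m + 1)) ∞ Y]

/-- The positivity statement `areaAt_proj_liftMap`, carried over to the coordinate `z` by conformal
covariance. -/
theorem areaDensity_nonneg_and {P : ReebCircleBundle m Y S} {h : ℝ → ℝ}
    {J : ∀ y : Y, (ℝ × TangentSpace (𝓡 (2 * m + 1)) y) →L[ℝ]
      (ℝ × TangentSpace (𝓡 (2 * m + 1)) y)} (hJ : IsAdmissibleJ P J)
    {Γ : Finset (ℝ × UnitAddCircle)} {b : ℝ × UnitAddCircle → ℝ} {v : ℝ × UnitAddCircle → Y}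
    {kp km : ℕ} {κ : ℝ × UnitAddCircle → ℕ} (hv : IsPuncturedFloerCylinder P h J Γ b v kp km κ)
    {w : C(OnePoint ℂ, S)} (hw : IsProjection P Γ v w)
    {z : ℂ} (hz : (z : OnePoint ℂ) ∉ range (cylEnd Γ)) :
    0 ≤ areaDensity P w z ∧ (areaDensity P w z = 0 →
      mfderiv 𝓘(ℝ, ℂ) (𝓡 (2 * m)) (fun z : ℂ => w z) z = 0) := by
  have hlift := contMDiffOn_liftMap hv.smooth_v
  have hev := hw.eventuallyEq hz
  have hdiff : MDifferentiableAt 𝓘(ℝ, ℂ) (𝓡 (2 * m)) (fun z : ℂ => w z) z :=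
    ((P.mdifferentiableAt_proj _).comp z (mdifferentiableAt_onPlane hlift hz)).congr_of_eventuallyEq
      hev
  obtain ⟨ζ, rfl, hζ⟩ := exists_expMap_of_notMem_range Γ hz
  have hμ : (2 * Real.pi * expMap ζ : ℂ) ≠ 0 := mul_ne_zero two_pi_ne_zero' (expMap_ne_zero ζ)
  have hev' : (fun z : ℂ => w z) ∘ expMap =ᶠ[𝓝 ζ] P.proj ∘ liftMap v := by
    rw [← onPlane_comp_expMap]
    exact (hasDerivAt_expMap ζ).continuousAt.eventually hev
  have h1 := P.areaAt_comp (hasDerivAt_expMap ζ) hdiff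
  rw [P.areaAt_congr hev'] at h1
  obtain ⟨h2, h3⟩ := areaAt_proj_liftMap hJ hv hζ
  change 0 ≤ P.areaAt (fun z : ℂ => w z) (expMap ζ) ∧ (P.areaAt (fun z : ℂ => w z) (expMap ζ) = 0 → _)
  rw [h1] at h2 h3
  refine ⟨nonneg_of_mul_nonneg_right h2 (by positivity), fun h0 => ?_⟩
  have h4 := h3 (by rw [h0, mul_zero])
  have hexp : HasMFDerivAt 𝓘(ℝ, ℂ) 𝓘(ℝ, ℂ) expMap ζ
      ((ContinuousLinearMap.toSpanSingleton ℂ (2 * Real.pi * expMap ζ)).restrictScalars ℝ) :=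
    ((hasDerivAt_expMap ζ).hasFDerivAt.restrictScalars ℝ).hasMFDerivAt
  have h5 := (hdiff.hasMFDerivAt.comp ζ hexp).mfderiv
  let D : ℂ →L[ℝ] EuclideanSpace ℝ (Fin (2 * m)) :=
    mfderiv 𝓘(ℝ, ℂ) (𝓡 (2 * m)) (fun z : ℂ => w z) (expMap ζ)
  have h6 : D.comp ((ContinuousLinearMap.toSpanSingleton ℂ
      (2 * Real.pi * expMap ζ)).restrictScalars ℝ) = 0 := by
    refine Eq.trans ?_ h4
    refine Eq.trans ?_ (hev'.mfderiv_eq (I := 𝓘(ℝ, ℂ)) (I' := 𝓡 (2 * m)))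
    exact h5.symm
  have h7 : D = 0 := by
    ext1 x
    have := DFunLike.congr_fun h6 (x / (2 * Real.pi * expMap ζ))
    simp only [ContinuousLinearMap.comp_apply, ContinuousLinearMap.coe_restrictScalars',
      ContinuousLinearMap.toSpanSingleton_apply, smul_eq_mul] at this
    rw [div_mul_cancel₀ _ hμ] at this
    exact this
  exact h7

/-- Off the punctures the area density is `K⁻¹ dβ` for the smooth form `β`, hence continuous. -/
theorem continuousOn_areaDensity {P : ReebCircleBundle m Y S} {K : ℝ} (hK : K ≠ 0)
    {Θ : ∀ y : Y, TangentSpace (𝓡 (2 * m + 1)) y →L[ℝ] ℝ} (hΘ : P.IsConnectionForm K Θ)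
    {Γ : Finset (ℝ × UnitAddCircle)} {v : ℝ × UnitAddCircle → Y}
    (hv : ContMDiffOn 𝓘(ℝ, ℂ) (𝓡 (2 * m + 1)) ∞ (liftMap v) {ζ | coverC ζ ∉ Γ})
    {w : C(OnePoint ℂ, S)} (hw : IsProjection P Γ v w) :
    ContinuousOn (areaDensity P w) {z : ℂ | (z : OnePoint ℂ) ∉ range (cylEnd Γ)} := by
  have h1 : ContinuousOn (fun z => K⁻¹ * planeExtD (planeForm Θ v) z)
      {z : ℂ | (z : OnePoint ℂ) ∉ range (cylEnd Γ)} := by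
    intro z hz
    have h2 : ContinuousAt (fderiv ℝ (planeForm Θ v)) z :=
      ((contDiffAt_planeForm hΘ.smooth hv hz).fderiv_right (m := 0) (by simp)).continuousAt
    exact (continuousAt_const.mul
      (((h2.clm_apply continuousAt_const).clm_apply continuousAt_const).sub
        ((h2.clm_apply continuousAt_const).clm_apply continuousAt_const))).continuousWithinAt
  refine h1.congr fun z hz => ?_
  beta_reduce
  rw [planeExtD_planeForm hΘ hv hz, inv_mul_cancel_left₀ hK]
  exact P.areaAt_congr (hw.eventuallyEq hz)

/-- A sphere of area zero is constant. -/
theorem const_of_symplecticArea_eq_zero [T2Space S] [IsManifold (𝓡 (2 * m)) ∞ S]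
    {P : ReebCircleBundle m Y S} {K : ℝ} (hK : K ≠ 0)
    {Θ : ∀ y : Y, TangentSpace (𝓡 (2 * m + 1)) y →L[ℝ] ℝ} (hΘ : P.IsConnectionForm K Θ) {h : ℝ → ℝ}
    {J : ∀ y : Y, (ℝ × TangentSpace (𝓡 (2 * m + 1)) y) →L[ℝ]
      (ℝ × TangentSpace (𝓡 (2 * m + 1)) y)} (hJ : IsAdmissibleJ P J)
    {Γ : Finset (ℝ × UnitAddCircle)} {b : ℝ × UnitAddCircle → ℝ} {v : ℝ × UnitAddCircle → Y}
    {kp km : ℕ} {κ : ℝ × UnitAddCircle → ℕ} (hv : IsPuncturedFloerCylinder P h J Γ b v kp km κ)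
    {w : C(OnePoint ℂ, S)} (hw : IsProjection P Γ v w) (hint : Integrable (areaDensity P w))
    (h0 : symplecticArea P w = 0) : ∃ x, ∀ y, w y = x := by
  set U := {z : ℂ | (z : OnePoint ℂ) ∉ range (cylEnd Γ)}
  have hU : IsOpen U := isOpen_compl_range_cylEnd Γ
  obtain ⟨hconn, hdense⟩ := isPreconnected_compl_range_cylEnd Γ
  have hlift := contMDiffOn_liftMap hv.smooth_v
  have hpos := fun (z : ℂ) (hz : z ∈ U) => areaDensity_nonneg_and hJ hv hw hz
  have hae : ∀ᵐ z : ℂ, z ∈ U :=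
    ae_notMem_range _
  have hzero : areaDensity P w =ᵐ[volume] 0 :=
    (integral_eq_zero_iff_of_nonneg_ae (hae.mono fun z hz => (hpos z hz).1) hint).1 h0
  have hzeroU : EqOn (areaDensity P w) 0 U :=
    Measure.eqOn_open_of_ae_eq (ae_restrict_of_ae hzero) hU
      (continuousOn_areaDensity hK hΘ hlift hw) continuousOn_const
  obtain ⟨z₀, hz₀⟩ := hdense.nonempty
  have hcU := eqOn_const_of_mfderiv_eq_zero (f := fun z : ℂ => w z) hU hconn (fun z hz =>
    ((P.mdifferentiableAt_proj _).comp z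
      (mdifferentiableAt_onPlane hlift hz)).congr_of_eventuallyEq (hw.eventuallyEq hz))
    (fun z hz => (hpos z hz).2 (hzeroU hz)) hz₀
  have h1 : (fun z : ℂ => w z) = fun _ => w z₀ :=
    Continuous.ext_on hdense (w.continuous.comp OnePoint.continuous_coe) continuous_const hcU
  have h2 : (w : OnePoint ℂ → S) = fun _ => w z₀ :=
    OnePoint.denseRange_coe.equalizer w.continuous continuous_const h1
  exact ⟨w z₀, fun y => congrFun h2 y⟩

end Sphere

end SplitFloer

end

theorem mainTheorem9 (m : ℕ)
    (Y : Type) [TopologicalSpace Y] [T2Space Y] [CompactSpace Y]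
    [ChartedSpace (EuclideanSpace ℝ (Fin (2 * m + 1))) Y] [IsManifold (𝓡 (2 * m + 1)) ∞ Y]
    (S : Type) [TopologicalSpace S] [T2Space S]
    [ChartedSpace (EuclideanSpace ℝ (Fin (2 * m))) S] [IsManifold (𝓡 (2 * m)) ∞ S]
    (P : SplitFloer.ReebCircleBundle m Y S)
    (K : ℝ) (hK : 0 < K) (hKN : P.IsNormalChernConstant K)
    (h : ℝ → ℝ) (hh : SplitFloer.IsAdmissibleProfile h)
    (J : ∀ y : Y, (ℝ × TangentSpace (𝓡 (2 * m + 1)) y) →L[ℝ]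
      (ℝ × TangentSpace (𝓡 (2 * m + 1)) y))
    (hJ : SplitFloer.IsAdmissibleJ P J)
    (Γ : Finset (ℝ × UnitAddCircle)) (b : ℝ × UnitAddCircle → ℝ) (v : ℝ × UnitAddCircle → Y)
    (kp km : ℕ) (κ : ℝ × UnitAddCircle → ℕ)
    (hv : SplitFloer.IsPuncturedFloerCylinder P h J Γ b v kp km κ)
    (w : C(OnePoint ℂ, S)) (hw : SplitFloer.IsProjection P Γ v w)
    (c : SplitFloer.H2 (OnePoint ℂ)) (hc : ∀ x : SplitFloer.H2 (OnePoint ℂ), ∃ j : ℤ, x = j • c) :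
    Integrable (SplitFloer.areaDensity P w) ∧
    (kp : ℝ) - km - ∑ z ∈ Γ, (κ z : ℝ) = K * SplitFloer.symplecticArea P w ∧
    0 ≤ K * SplitFloer.symplecticArea P w ∧
    ((SplitFloer.H2map w c ≠ 0 ∨ Γ.Nonempty) → km < kp) := by
  open SplitFloer in
  obtain ⟨Θ, hΘ⟩ := hKN
  have hlift := contMDiffOn_liftMap hv.smooth_v
  have hae : ∀ᵐ z : ℂ, (z : OnePoint ℂ) ∉ range (cylEnd Γ) :=
    ae_notMem_range _
  have hd : ∀ z : ℂ, (z : OnePoint ℂ) ∉ range (cylEnd Γ) →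
      planeExtD (planeForm Θ v) z = K * areaDensity P w z := fun z hz => by
    rw [planeExtD_planeForm hΘ hlift hz]
    exact congrArg (K * ·) (P.areaAt_congr (hw.eventuallyEq hz).symm)
  -- The fluxes at `∞`, at `0`, and at the augmentation punctures.
  let φ : Option (Option Γ) → ℝ
    | none => kp
    | some none => -km
    | some (some z) => -κ z
  have hflux : ∀ i, HasFlux (planeForm Θ v) (cylEnd Γ i) (φ i) := by
    rintro (_ | _ | z)
    · obtain ⟨c, γ, hγ, -, hg⟩ := hv.plus_end
      exact hasFlux_plus hΘ hlift hg hγ.hasMFDerivAt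
    · rcases hv.minus_end with ⟨c, γ, hγ, -, hg⟩ | ⟨γ, hγ, -, hg⟩
      · exact hasFlux_minus hΘ hlift hg hγ.hasMFDerivAt
      · exact hasFlux_minus hΘ hlift hg hγ.2
    · obtain ⟨γ, hγ, -, hg⟩ := hv.punctures z z.2
      exact hasFlux_puncture hΘ hlift z.1 hg hγ.2
  obtain ⟨hint, hsum⟩ := integral_planeExtD_eq_sum_flux (cylEnd_injective Γ) ⟨none, rfl⟩
    (fun z hz => (contDiffAt_planeForm hΘ.smooth hlift hz).of_le (by simp))
    (fun z hz => by
      rw [hd z hz]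
      exact mul_nonneg hK.le (areaDensity_nonneg_and hJ hv hw hz).1) hflux
  have hcongr : planeExtD (planeForm Θ v) =ᵐ[volume] fun z => K * areaDensity P w z := hae.mono hd
  have hint' : Integrable (areaDensity P w) := by
    have h1 := (hint.congr hcongr).const_mul K⁻¹
    simpa only [inv_mul_cancel_left₀ hK.ne'] using h1
  have heq : (kp : ℝ) - km - ∑ z ∈ Γ, (κ z : ℝ) = K * symplecticArea P w := by
    rw [symplecticArea, ← integral_const_mul, ← integral_congr_ae hcongr, hsum,
      Fintype.sum_option, Fintype.sum_option]
    simp only [φ, Finset.sum_neg_distrib]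
    rw [Finset.univ_eq_attach, Finset.sum_attach Γ fun z => (κ z : ℝ)]
    ring
  have hnn : 0 ≤ K * symplecticArea P w := mul_nonneg hK.le
    (integral_nonneg_of_ae (hae.mono fun z hz => (areaDensity_nonneg_and hJ hv hw hz).1))
  refine ⟨hint', heq, hnn, fun hne => ?_⟩
  by_contra! hle
  have hle' : (kp : ℝ) ≤ km := by exact_mod_cast hle
  have hκ : 0 ≤ ∑ z ∈ Γ, (κ z : ℝ) := Finset.sum_nonneg fun z _ => Nat.cast_nonneg _
  rcases hne with hne | hne
  · have h0 : symplecticArea P w = 0 := by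
      have : K * symplecticArea P w = 0 := by linarith
      exact (mul_eq_zero.1 this).resolve_left hK.ne'
    obtain ⟨x, hx⟩ := const_of_symplecticArea_eq_zero hK.ne' hΘ hJ hv hw hint' h0
    exact hne (H2map_eq_zero_of_const w hx c)
  · have : 0 < ∑ z ∈ Γ, (κ z : ℝ) := by
      refine Finset.sum_pos (fun z hz => ?_) hne
      obtain ⟨γ, hγ, -⟩ := hv.punctures z hz
      exact_mod_cast hγ.1
    linarith
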